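/- **Setting.** Let $k$ be a commutative ring and $\mathcal T$ a small dg-category over $k$. Write $C(k)$ for the dg-category of cochain complexes of $k$-modules. A left (right) $\mathcal T$-module is a dg-functor $\mathcal T\to C(k)$ (resp. $\mathcal T^{op}\to C(k)$); $h_x=\mathcal T(-,x)$. A morphism of modules is a closed natural family $f=(f_x)_x$ of degree $0$. For a right module $X$ and a left module $M$, $X\otimes_{\mathcal T}M$ is the (underived) quotient of $\bigoplus_z X(z)\otimes_k M(z)$ by the relations $X(f)(x)\otimes m=(-1)^{|f||x|}x\otimes M(f)(m)$. An $n$-fold bimodule is a dg-functor $F(x_1,\dots,x_n;w)$ to $C(k)$, covariant in $x_1,\dots,x_n\in\mathcal T$ and contravariant in $w$. For a right module $X$, $F(\dots,X,\dots;w)$ denotes the tensor product over $\mathcal T$ of $X$ with the covariant variable in that slot; in particular $F(\dots,G(\dots),\dots)$ is a composite of bimodules. A *pseudo dg-tensor structure* on $\mathcal T$ consists of a $2$-fold bimodule $\Gamma$, a right module $U$ and closed degree-$0$ morphisms of bimodules $$\alpha_{x,y,z}:\Gamma(x,\Gamma(y,z))\to\Gamma(\Gamma(x,y),z),\quad \ell_x:\Gamma(U,x)\to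 h_x,\quad r_x:\Gamma(x,U)\to h_x,\quad c_{x,y}:\Gamma(x,y)\to\Gamma(y,x),$$ such that: * (invertibility) after inserting arbitrary right modules $X,Y,Z$ for the variables, $\alpha,\ell,r,c$ are homotopy equivalences of complexes at every object $w$; and for all objects $x,y,z$ of $\mathcal T$ the components $\alpha_{x,y,z},\ell_x,r_x,c_{x,y}$ are isomorphisms in the homotopy category $H^0$ of right $\mathcal T$-modules; * (coherence) there are degree $-1$ morphisms of bimodules $\eta,\mu,\sigma,\kappa,\nu$ with $$\alpha_{\Gamma(x,y),z,w}\,\alpha_{x,y,\Gamma(z,w)}-\Gamma(\alpha_{x,y,z},w)\,\alpha_{x,\Gamma(y,z),w}\,\Gamma(x,\alpha_{y,z,w})=d\eta,$$ $$\Gamma(r_x,y)\,\alpha_{x,U,y}-\Gamma(x,\ell_y)=d\mu,\qquad c_{y,x}c_{x,y}-\mathrm{id}=d\sigma,\qquad \ell_x\,c_{x,U}-r_x=d\kappa,$$ $$\Gamma(c_{x,z},y)\,\alpha_{x,z,y}\,\Gamma(x,c_{y,z})-\alpha_{z,x,y}\,c_{\Gamma(x,y),z}\,\alpha_{x,y,z}=d\nu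 .$$ It is *perfect* if for all objects $x,y$ the right module $\Gamma(x,y;-)$ is quasi-isomorphic (isomorphic in the derived category) to some $h_z$, and if for all perfect (that is, cofibrant and compact in the derived category) right modules $X,Y$ the right module $\Gamma(X,Y;-)=\Gamma\otimes X\otimes Y$ is quasi-isomorphic to a perfect right module. A class $\mathcal P$ of chain maps of complexes of $k$-modules is *homotopically replete* if, for every commutative square of chain maps $b f=g a$ with $f:A\to B$, $g:A'\to B'$ and homotopy equivalences $a:A\to A'$, $b:B\to B'$, $f\in\mathcal P$ implies $g\in\mathcal P$. A morphism $f$ of left or right $\mathcal T$-modules is said to lie in $\mathcal P$ if $f_x\in\mathcal P$ for all objects $x$. $\mathcal P$ is *stable under tensoring with dg-modules* if $X\otimes_{\mathcal T}f\in\mathcal P$ for every right module $X$ and every morphism $f$ of left modules lying in $\mathcal P$, and $g\otimes_{\mathcal T}M\in\mathcal P$ for every left module $M$ and every morphism $g$ of right modules lying in $\mathcal P$. **Proposition.** Let $\Gamma$ be a perfect pseudo dg-tensor structure on $\mathcal T$, and let $\mathcal P$ be a homotopically replete class of chain maps that is stable under tensoring with dg-modules. Then: 1. a morphism $f$ of left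 $\mathcal T$-modules lies in $\mathcal P$ if and only if $\Gamma\otimes f$ does, i.e. $\Gamma(x,y;-)\otimes_{\mathcal T}f\in\mathcal P$ for all objects $x,y$; 2. a morphism $g$ of right $\mathcal T$-modules lies in $\mathcal P$ if and only if $g\otimes\Gamma$ does, i.e. $g\otimes_{\mathcal T}\Gamma(-,y;w)\in\mathcal P$ for all objects $y,w$. -/

import Mathlib

open CategoryTheory CochainComplex.HomComplex

universe w u v u₁ v₁ u₂ v₂ u₃ v₃

theorem sgn_congr {a b : ℤ} (h : Even (a - b)) : Int.negOnePow a = Int.negOnePow b :=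
  (Int.negOnePow_eq_iff a b).2 h

theorem map_sgn {k : Type*} [CommRing k] {M N : Type*} [AddCommGroup M] [Module k M]
    [AddCommGroup N] [Module k N] (f : M →ₗ[k] N) (e : ℤˣ) (x : M) : f (e • x) = e • f x := by
  rw [Units.smul_def, Units.smul_def, map_zsmul]

theorem map_sgn₂ {k : Type*} [CommRing k] {M N P : Type*} [AddCommGroup M] [Module k M]
    [AddCommGroup N] [Module k N] [AddCommGroup P] [Module k P]
    (f : M →ₗ[k] N →ₗ[k] P) (e : ℤˣ) (x : M) (y : N) : f (e • x) y = e • f x y := by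
  rw [Units.smul_def, Units.smul_def, map_zsmul]; rfl

/-- A dg-category over `k`: a category enriched over cochain complexes of `k`-modules.
`comp h f g` is the composite "first `f`, then `g`", that is `g ∘ f`.  The differential
`d n m` is zero unless `n + 1 = m`. -/
structure DGCat (k : Type w) [CommRing k] where
  Obj : Type u
  Hom : Obj → Obj → ℤ → Type v
  [addCommGroup : ∀ x y n, AddCommGroup (Hom x y n)]
  [module : ∀ x y n, Module k (Hom x y n)]
  d : ∀ {x y : Obj} (n m : ℤ), Hom x y n →ₗ[k] Hom x y m
  d_shape : ∀ {x y : Obj} (n m : ℤ), ¬ n + 1 = m → ∀ f : Hom x y n, d n m f = 0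
  d_d : ∀ {x y : Obj} (n m l : ℤ) (f : Hom x y n), d m l (d n m f) = 0
  id : ∀ x, Hom x x 0
  comp : ∀ {x y z : Obj} {p q n : ℤ}, p + q = n → Hom x y p →ₗ[k] Hom y z q →ₗ[k] Hom x z n
  id_comp : ∀ {x y : Obj} {n : ℤ} (f : Hom x y n), comp (zero_add n) (id x) f = f
  comp_id : ∀ {x y : Obj} {n : ℤ} (f : Hom x y n), comp (add_zero n) f (id y) = f
  assoc : ∀ {x y z t : Obj} {p q r pq qr n : ℤ} (h₁ : p + q = pq) (h₂ : pq + r = n)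
    (h₃ : q + r = qr) (h₄ : p + qr = n) (f : Hom x y p) (g : Hom y z q) (e : Hom z t r),
    comp h₂ (comp h₁ f g) e = comp h₄ f (comp h₃ g e)
  d_comp : ∀ {x y z : Obj} {p q n p' q' n' : ℤ} (h : p + q = n) (_ : p + 1 = p')
    (_ : q + 1 = q') (h₁ : p + q' = n') (h₂ : p' + q = n') (f : Hom x y p) (g : Hom y z q),
    d n n' (comp h f g) = comp h₁ f (d q q' g) + Int.negOnePow q • comp h₂ (d p p' f) g

attribute [instance] DGCat.addCommGroup DGCat.module

namespace DGCat

variable {k : Type w} [CommRing k]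

theorem d_id (A : DGCat.{w, u, v} k) (x : A.Obj) : A.d 0 1 (A.id x) = 0 := by
  have h := A.d_comp (zero_add 0) (zero_add 1) (zero_add 1) (zero_add 1) (add_zero 1)
    (A.id x) (A.id x)
  rw [A.id_comp, A.id_comp, A.comp_id] at h
  simpa using h

/-- The complex of morphisms from `x` to `y`. -/
def homComplex (A : DGCat.{w, u, v} k) (x y : A.Obj) : CochainComplex (ModuleCat.{v} k) ℤ where
  X n := ModuleCat.of k (A.Hom x y n)
  d n m := ModuleCat.ofHom (A.d n m)
  shape n m h := by
    ext f
    exact A.d_shape n m h f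
  d_comp_d' n m l _ _ := by
    ext f
    exact A.d_d n m l f

/-- The opposite dg-category, with the Koszul sign in its composition. -/
abbrev op (A : DGCat.{w, u, v} k) : DGCat.{w, u, v} k where
  Obj := A.Obj
  Hom x y n := A.Hom y x n
  d n m := A.d n m
  d_shape n m h f := A.d_shape n m h f
  d_d n m l f := A.d_d n m l f
  id x := A.id x
  comp {x y z p q n} h := Int.negOnePow (p * q) • (A.comp (by omega)).flip
  id_comp f := by
    simpa [Units.smul_def] using A.comp_id f
  comp_id f := by
    simpa [Units.smul_def] using A.id_comp f
  assoc {x y z t p q r pq qr n} h₁ h₂ h₃ h₄ f g e := by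
    subst h₁ h₃
    simp only [LinearMap.smul_apply, LinearMap.flip_apply, map_sgn, smul_smul]
    rw [A.assoc (pq := q + r) (qr := p + q) (n := n) (by omega) (by omega) (by omega) (by omega)
      e g f]
    rw [← Int.negOnePow_add, ← Int.negOnePow_add]
    congr 1
    exact sgn_congr ⟨0, by ring⟩
  d_comp {x y z p q n p' q' n'} h hp hq h₁ h₂ f g := by
    subst hp hq
    simp only [LinearMap.smul_apply, LinearMap.flip_apply, map_sgn]
    rw [A.d_comp (p' := q + 1) (q' := p + 1) (n' := n') _ rfl rfl (by omega) (by omega),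
      smul_add, smul_smul, smul_smul, add_comm, ← Int.negOnePow_add, ← Int.negOnePow_add]
    congr 2
    · exact sgn_congr ⟨0, by ring⟩
    · exact sgn_congr ⟨-q, by ring⟩

/-- The dg-category of cochain complexes of `k`-modules. -/
noncomputable abbrev complexes (k : Type w) [CommRing k] : DGCat.{w, max w (v + 1), v} k where
  Obj := CochainComplex (ModuleCat.{v} k) ℤ
  Hom K L n := Cochain K L n
  d n m := δ_hom k _ _ n m
  d_shape n m h f := δ_shape n m h f
  d_d n m l f := δ_δ n m l f
  id K := Cochain.ofHom (𝟙 K)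
  comp {K L M p q n} h := LinearMap.mk₂ k (fun f g => f.comp g h)
    (fun f f' g => Cochain.add_comp f f' g h) (fun c f g => Cochain.smul_comp c f g h)
    (fun f g g' => Cochain.comp_add f g g' h) (fun c f g => Cochain.comp_smul f c g h)
  id_comp f := Cochain.id_comp f
  comp_id f := Cochain.comp_id f
  assoc h₁ h₂ h₃ h₄ f g e := by
    exact Cochain.comp_assoc f g e h₁ h₃ (by omega)
  d_comp {x y z p q n p' q' n'} h hp hq h₁ h₂ f g := 
    δ_comp f g h p' q' n' (by omega) hp hq 

end DGCat

variable {k : Type w} [CommRing k]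

/-- A dg-functor. -/
structure DGFunctor (A : DGCat.{w, u₁, v₁} k) (B : DGCat.{w, u₂, v₂} k) where
  obj : A.Obj → B.Obj
  map : ∀ {x y : A.Obj} {n : ℤ}, A.Hom x y n →ₗ[k] B.Hom (obj x) (obj y) n
  map_d : ∀ {x y : A.Obj} (n m : ℤ) (f : A.Hom x y n), map (A.d n m f) = B.d n m (map f)
  map_id : ∀ x : A.Obj, map (A.id x) = B.id (obj x)
  map_comp : ∀ {x y z : A.Obj} {p q n : ℤ} (h : p + q = n) (f : A.Hom x y p) (g : A.Hom y z q),
    map (A.comp h f g) = B.comp h (map f) (map g)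

namespace DGFunctor

variable {A : DGCat.{w, u₁, v₁} k} {B : DGCat.{w, u₂, v₂} k} {C : DGCat.{w, u₃, v₃} k}

/-- Composition of dg-functors: first `F`, then `G`. -/
def comp (F : DGFunctor A B) (G : DGFunctor B C) : DGFunctor A C where
  obj x := G.obj (F.obj x)
  map := G.map ∘ₗ F.map
  map_d n m f := by simp [F.map_d, G.map_d]
  map_id x := by simp [F.map_id, G.map_id]
  map_comp h f g := by simp [F.map_comp, G.map_comp]

/-- The natural families of degree `n` between two dg-functors. -/
def natFamilies (F G : DGFunctor A B) (n : ℤ) :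
    Submodule k (∀ x, B.Hom (F.obj x) (G.obj x) n) where
  carrier := {φ | ∀ (x y : A.Obj) (p m : ℤ) (h : n + p = m) (h' : p + n = m) (f : A.Hom x y p),
    B.comp h (φ x) (G.map f) = Int.negOnePow (n * p) • B.comp h' (F.map f) (φ y)}
  add_mem' {φ ψ} hφ hψ x y p m h h' f := by
    simp [hφ x y p m h h' f, hψ x y p m h h' f]
  zero_mem' x y p m h h' f := by simp
  smul_mem' c φ hφ x y p m h h' f := by
    simp [hφ x y p m h h' f, smul_comm c]

end DGFunctor

/-- The dg-category of dg-functors from `A` to `B`: a morphism of degree `n` is a family of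
morphisms of degree `n` that is natural in the graded sense. -/
abbrev DGCat.functors (A : DGCat.{w, u₁, v₁} k) (B : DGCat.{w, u₂, v₂} k) :
    DGCat.{w, max u₁ v₁ u₂ v₂, max u₁ v₂} k where
  Obj := DGFunctor A B
  Hom F G n := DGFunctor.natFamilies F G n
  d {F G} n m := LinearMap.restrict (LinearMap.pi fun x => B.d n m ∘ₗ LinearMap.proj x) (by
    intro φ hφ x y p l h h' f
    by_cases hm : n + 1 = m
    swap
    · simp [B.d_shape n m hm]
    have e1 := B.d_comp (p' := m) (q' := p + 1) (n := n + p) (n' := l) rfl hm rfl (by omega)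
      (by omega) (φ x) (G.map f)
    have e2 := B.d_comp (p' := p + 1) (q' := m) (n := n + p) (n' := l) (by omega) rfl hm
      (by omega) (by omega) (F.map f) (φ y)
    rw [hφ x y p _ rfl (by omega) f, map_sgn, e2, ← G.map_d, hφ x y (p + 1) l (by omega)
      (by omega), F.map_d] at e1
    simp only [LinearMap.pi_apply, LinearMap.comp_apply, LinearMap.proj_apply]
    have e3 := congrArg (fun t => Int.negOnePow p • t) e1
    simp only [smul_add, smul_smul, ← Int.negOnePow_add] at e3
    rw [add_comm, sgn_congr (a := p + n * (p + 1)) (b := p + (n * p + n)) ⟨0, by ring⟩,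
      add_right_inj, sgn_congr (a := p + p) (b := 0) ⟨p, by ring⟩] at e3
    simp only [Int.negOnePow_zero, one_smul] at e3
    rw [← e3]
    congr 1
    exact sgn_congr ⟨0, by rw [← hm]; ring⟩)
  d_shape n m h f := by
    ext x
    exact B.d_shape n m h _
  d_d n m l f := by
    ext x
    exact B.d_d n m l _
  id F := ⟨fun x => B.id (F.obj x), fun x y p m h h' f => by
    obtain rfl : p = m := by omega
    rw [B.id_comp, B.comp_id]
    simp⟩
  comp {F G H p q n} h := LinearMap.mk₂ k (fun φ ψ => ⟨fun x => B.comp h (φ.1 x) (ψ.1 x),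
      fun x y r m h₁ h₂ f => by
        dsimp only
        rw [B.assoc (qr := q + r) h h₁ rfl (by omega), ψ.2 x y r _ rfl (by omega), map_sgn,
          ← B.assoc (pq := p + r) rfl (by omega),
          φ.2 x y r _ rfl (by omega), map_sgn₂,
          B.assoc (qr := n) (n := m) (by omega) (by omega) h (by omega), smul_smul,
          ← Int.negOnePow_add]
        congr 1
        exact sgn_congr ⟨0, by rw [← h]; ring⟩⟩)
    (fun _ _ _ => by ext x; simp) (fun _ _ _ => by ext x; simp)
    (fun _ _ _ => by ext x; simp) (fun _ _ _ => by ext x; simp)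
  id_comp f := by
    ext x
    exact B.id_comp _
  comp_id f := by
    ext x
    exact B.comp_id _
  assoc h₁ h₂ h₃ h₄ f g e := by
    ext x
    exact B.assoc h₁ h₂ h₃ h₄ _ _ _
  d_comp h hp hq h₁ h₂ f g := by
    ext x
    exact B.d_comp h hp hq h₁ h₂ _ _

theorem DGCat.functors_ext {A : DGCat.{w, u₁, v₁} k} {B : DGCat.{w, u₂, v₂} k}
    {F G : DGFunctor A B} {n : ℤ} {φ ψ : (A.functors B).Hom F G n} (h : ∀ a, φ.1 a = ψ.1 a) :
    φ = ψ := Subtype.ext (funext h)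

namespace DGFunctor

variable {A : DGCat.{w, u₁, v₁} k} {B : DGCat.{w, u₂, v₂} k} {C : DGCat.{w, u₃, v₃} k}

/-- Evaluation at an object. -/
def ev (B : DGCat.{w, u₂, v₂} k) (a : A.Obj) : DGFunctor (A.functors B) B where
  obj F := F.obj a
  map := { toFun := fun φ => φ.1 a, map_add' := fun _ _ => rfl, map_smul' := fun _ _ => rfl }
  map_d _ _ _ := rfl
  map_id _ := rfl
  map_comp _ _ _ := rfl

/-- Composition with a fixed dg-functor `K` on the source side. -/
def pre (K : DGFunctor A B) (C : DGCat.{w, u₃, v₃} k) :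
    DGFunctor (B.functors C) (A.functors C) where
  obj F := K.comp F
  map := { toFun := fun φ => ⟨fun a => φ.1 (K.obj a), fun _ _ p m h h' f =>
             φ.2 _ _ p m h h' (K.map f)⟩
           map_add' := fun _ _ => rfl, map_smul' := fun _ _ => rfl }
  map_d _ _ _ := rfl
  map_id _ := rfl
  map_comp _ _ _ := rfl

/-- Composition with a fixed dg-functor `F` on the target side. -/
def post (A : DGCat.{w, u₁, v₁} k) (F : DGFunctor B C) :
    DGFunctor (A.functors B) (A.functors C) where
  obj K := K.comp F
  map := { toFun := fun φ => ⟨fun a => F.map (φ.1 a), fun x y p m h h' f => by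
             have := congrArg F.map (φ.2 x y p m h h' f)
             rwa [map_sgn, F.map_comp, F.map_comp] at this⟩
           map_add' := fun _ _ => DGCat.functors_ext fun a => by exact map_add F.map _ _
           map_smul' := fun _ _ => DGCat.functors_ext fun a => by exact map_smul F.map _ _ }
  map_d _ _ _ := DGCat.functors_ext fun a => by exact F.map_d _ _ _
  map_id _ := DGCat.functors_ext fun a => by exact F.map_id _
  map_comp _ _ _ := DGCat.functors_ext fun a => by exact F.map_comp _ _ _

/-- `post` is itself a dg-functor of the dg-functor one composes with. -/
def postFunctor (A : DGCat.{w, u₁, v₁} k) (B : DGCat.{w, u₂, v₂} k) (C : DGCat.{w, u₃, v₃} k) :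
    DGFunctor (B.functors C) ((A.functors B).functors (A.functors C)) where
  obj F := post A F
  map := { toFun := fun ψ => ⟨fun K => ⟨fun a => ψ.1 (K.obj a), fun _ _ p m h h' f =>
             ψ.2 _ _ p m h h' (K.map f)⟩, fun x y p m h h' f => DGCat.functors_ext fun a => by
               exact ψ.2 _ _ p m h h' (f.1 a)⟩
           map_add' := fun _ _ => rfl, map_smul' := fun _ _ => rfl }
  map_d _ _ _ := rfl
  map_id _ := rfl
  map_comp _ _ _ := rfl

/-- Exchange of two variables. -/
def flip (F : DGFunctor A (B.functors C)) : DGFunctor B (A.functors C) where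
  obj b := F.comp (ev C b)
  map {b b' n} :=
    { toFun := fun g => ⟨fun a => (F.obj a).map g, fun x y p m h h' f => by
        have := (F.map f).2 b b' n m h' h g
        have e : Int.negOnePow (n * p) • Int.negOnePow (p * n) •
            C.comp h ((F.obj x).map g) ((F.map f).1 b') = C.comp h ((F.obj x).map g) ((F.map f).1 b') := by
          rw [smul_smul, ← Int.negOnePow_add, sgn_congr (b := 0) ⟨n * p, by ring⟩]
          simp
        exact (e.symm.trans (congrArg _ this.symm))⟩
      map_add' := fun _ _ => DGCat.functors_ext fun a => by exact map_add (F.obj a).map _ _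
      map_smul' := fun _ _ => DGCat.functors_ext fun a => by exact map_smul (F.obj a).map _ _ }
  map_d _ _ _ := DGCat.functors_ext fun a => by exact (F.obj a).map_d _ _ _
  map_id _ := DGCat.functors_ext fun a => by exact (F.obj a).map_id _
  map_comp _ _ _ := DGCat.functors_ext fun a => by exact (F.obj a).map_comp _ _ _

/-- Exchange of two variables, as a dg-functor. -/
def flipFunctor (A : DGCat.{w, u₁, v₁} k) (B : DGCat.{w, u₂, v₂} k) (C : DGCat.{w, u₃, v₃} k) :
    DGFunctor (A.functors (B.functors C)) (B.functors (A.functors C)) where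
  obj F := F.flip
  map := { toFun := fun φ => ⟨fun b => ⟨fun a => (φ.1 a).1 b, fun x y p m h h' f =>
               congrArg (fun t => t.1 b) (φ.2 x y p m h h' f)⟩, fun x y p m h h' g => DGCat.functors_ext fun a => by
               exact (φ.1 a).2 x y p m h h' g⟩
           map_add' := fun _ _ => rfl, map_smul' := fun _ _ => rfl }
  map_d _ _ _ := rfl
  map_id _ := rfl
  map_comp _ _ _ := rfl

end DGFunctor

namespace DGCat

variable (A : DGCat.{w, u, v} k)

/-- Closed morphisms of degree zero. -/
def Closed (x y : A.Obj) : Type v := {f : A.Hom x y 0 // A.d 0 1 f = 0}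

/-- `f` and `g` differ by the differential of a morphism of degree `-1`. -/
def Homotopic {x y : A.Obj} (f g : A.Hom x y 0) : Prop :=
  ∃ h : A.Hom x y (-1), f - g = A.d (-1) 0 h

/-- `f` is a closed morphism of degree zero which becomes an isomorphism in `H⁰(A)`. -/
def IsH0Iso {x y : A.Obj} (f : A.Hom x y 0) : Prop :=
  A.d 0 1 f = 0 ∧ ∃ g : A.Hom y x 0, A.d 0 1 g = 0 ∧
    A.Homotopic (A.comp (add_zero 0) f g) (A.id x) ∧
    A.Homotopic (A.comp (add_zero 0) g f) (A.id y)

end DGCat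

section Tensor

variable {k : Type u} [CommRing k] {T : DGCat.{u, u, u} k}

/-- The dg-category of left modules: dg-functors `T → C(k)`. -/
noncomputable abbrev LMod (T : DGCat.{u, u, u} k) : DGCat.{u, u + 1, u} k :=
  T.functors (DGCat.complexes.{u, u} k)

/-- The dg-category of right modules: dg-functors `Tᵒᵖ → C(k)`. -/
noncomputable abbrev RMod (T : DGCat.{u, u, u} k) : DGCat.{u, u + 1, u} k :=
  T.op.functors (DGCat.complexes.{u, u} k)

/-- The values of a graded map. -/
noncomputable def ap {K L : CochainComplex (ModuleCat.{u} k) ℤ} {n : ℤ} (z : Cochain K L n) (i j : ℤ)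
    (h : i + n = j) : K.X i →ₗ[k] L.X j := (z.v i j h).hom

section
variable {K L M : CochainComplex (ModuleCat.{u} k) ℤ}

/-- The differential of a complex. -/
noncomputable abbrev dd (K : CochainComplex (ModuleCat.{u} k) ℤ) (i j : ℤ) : K.X i →ₗ[k] K.X j := (K.d i j).hom

theorem dd_dd (i j l : ℤ) (x : K.X i) : dd K j l (dd K i j x) = 0 := by
  exact congrArg (fun f => f.hom x) (K.d_comp_d i j l)

theorem ap_comp {p q n : ℤ} (h : p + q = n) (f : Cochain K L p) (g : Cochain L M q) (i j l : ℤ)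
    (h₁ : i + p = j) (h₂ : j + q = l) (h₃ : i + n = l) (x : K.X i) :
    ap (f.comp g h) i l h₃ x = ap g j l h₂ (ap f i j h₁ x) := by
  have := Cochain.comp_v f g h i j l h₁ h₂
  exact congrArg (fun t => t.hom x) this

theorem ap_d {n m : ℤ} (hm : n + 1 = m) (z : Cochain K L n) (i j i' j' : ℤ) (h : i + m = j)
    (hi : i + 1 = i') (hj : i + n = j') (hij : i' + n = j) (x : K.X i) :
    ap (δ n m z) i j h x = dd L j' j (ap z i j' hj x) - Int.negOnePow n • ap z i' j hij (dd K i i' x) := by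
  have := δ_v n m hm z i j h j' i' (by omega) hi
  have e := congrArg (fun t => t.hom x) this
  refine e.trans ?_
  subst hm
  simp only [Int.negOnePow_succ, ModuleCat.hom_add, ModuleCat.hom_comp, ap, Units.neg_smul,
    sub_eq_add_neg, ModuleCat.hom_neg, LinearMap.add_apply, LinearMap.neg_apply, 
    LinearMap.comp_apply]
  rfl

theorem ap_ext {n : ℤ} {z z' : Cochain K L n} (H : ∀ i j h x, ap z i j h x = ap z' i j h x) :
    z = z' := by
  ext i j h x
  exact H i j h x

@[simp] theorem ap_add {n : ℤ} (z z' : Cochain K L n) (i j : ℤ) (h : i + n = j) (x : K.X i) :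
    ap (z + z') i j h x = ap z i j h x + ap z' i j h x := rfl

@[simp] theorem ap_smul {n : ℤ} (c : k) (z : Cochain K L n) (i j : ℤ) (h : i + n = j) (x : K.X i) :
    ap (c • z) i j h x = c • ap z i j h x := rfl

@[simp] theorem ap_sgn {n : ℤ} (e : ℤˣ) (z : Cochain K L n) (i j : ℤ) (h : i + n = j) (x : K.X i) :
    ap (e • z) i j h x = e • ap z i j h x := rfl

/-- A graded map given by its values. -/
noncomputable def mkC {n : ℤ} (φ : ∀ i j : ℤ, i + n = j → (K.X i →ₗ[k] L.X j)) : Cochain K L n :=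
  Cochain.mk fun i j h => ModuleCat.ofHom (φ i j h)

@[simp] theorem ap_mkC {n : ℤ} (φ : ∀ i j : ℤ, i + n = j → (K.X i →ₗ[k] L.X j)) (i j : ℤ)
    (h : i + n = j) : ap (mkC φ) i j h = φ i j h := rfl

end


open TensorProduct DirectSum

/-- The value of a module at an object. -/
noncomputable abbrev cx {A : DGCat.{u, u₁, v₁} k} (M : DGFunctor A (DGCat.complexes.{u, u} k)) (a : A.Obj) :
    CochainComplex (ModuleCat.{u} k) ℤ := M.obj a

/-- The action of a morphism of degree `p` on a module. -/
noncomputable abbrev act {A : DGCat.{u, u₁, v₁} k} (M : DGFunctor A (DGCat.complexes.{u, u} k)) {a b : A.Obj}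
    {p : ℤ} (f : A.Hom a b p) (i j : ℤ) (h : i + p = j) :
    (cx M a).X i →ₗ[k] (cx M b).X j := ap (K := cx M a) (L := cx M b) (M.map f) i j h

/-- The values of a graded morphism of modules. -/
noncomputable abbrev hap {A : DGCat.{u, u₁, v₁} k} {M N : DGFunctor A (DGCat.complexes.{u, u} k)} {n : ℤ}
    (φ : (A.functors (DGCat.complexes.{u, u} k)).Hom M N n) (a : A.Obj) (i j : ℤ)
    (h : i + n = j) : (cx M a).X i →ₗ[k] (cx N a).X j := ap (K := cx M a) (L := cx N a) (φ.1 a) i j h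

section
variable {A : DGCat.{u, u₁, v₁} k} {M N : DGFunctor A (DGCat.complexes.{u, u} k)}

theorem act_d {a b : A.Obj} {p : ℤ} (f : A.Hom a b p) (i j i' j' : ℤ) (h : i + p = j)
    (hi : i + 1 = i') (hj : j + 1 = j') (x : (cx M a).X i) :
    dd (cx M b) j j' (act M f i j h x) = act M (A.d p (p + 1) f) i j' (by omega) x +
      Int.negOnePow p • act M f i' j' (by omega) (dd (cx M a) i i' x) := by
  have := ap_d (K := cx M a) (L := cx M b) rfl (M.map f) i j' i' j (by omega) hi h (by omega) x
  have e := M.map_d p (p + 1) f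
  unfold act
  rw [e]
  refine eq_add_of_sub_eq ?_
  exact this.symm

theorem hap_nat {n : ℤ} (φ : (A.functors (DGCat.complexes.{u, u} k)).Hom M N n) {a b : A.Obj}
    {p : ℤ} (f : A.Hom a b p) (i j l j' : ℤ) (h₁ : i + n = j) (h₂ : j + p = l) (h₃ : i + p = j')
    (h₄ : j' + n = l) (x : (cx M a).X i) :
    act N f j l h₂ (hap φ a i j h₁ x) =
      Int.negOnePow (n * p) • hap φ b j' l h₄ (act M f i j' h₃ x) := by
  have := φ.2 a b p (n + p) rfl (add_comm _ _) f
  have e1 := ap_comp (K := cx M a) (L := cx N a) (M := cx N b) rfl (φ.1 a) (N.map f) i j l h₁ h₂ (by omega) x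
  have e2 := ap_comp (K := cx M a) (L := cx M b) (M := cx N b) (add_comm p n) (M.map f) (φ.1 b) i j' l h₃ h₄ (by omega) x
  refine e1.symm.trans (Eq.trans ?_ (congrArg _ e2))
  exact congrArg (fun t : Cochain (cx M a) (cx N b) (n + p) => ap t i l (by omega) x) this

theorem hap_d {n m : ℤ} (hm : n + 1 = m) (φ : (A.functors (DGCat.complexes.{u, u} k)).Hom M N n)
    (a : A.Obj) (i j i' j' : ℤ) (h : i + m = j)
    (hi : i + 1 = i') (hj : i + n = j') (hij : i' + n = j) (x : (cx M a).X i) :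
    hap ((A.functors (DGCat.complexes.{u, u} k)).d n m φ) a i j h x =
      dd (cx N a) j' j (hap φ a i j' hj x) -
        Int.negOnePow n • hap φ a i' j hij (dd (cx M a) i i' x) :=
  ap_d (K := cx M a) (L := cx N a) hm (φ.1 a) i j i' j' h hi hj hij x

end

/-- Indices of the summands of the tensor product in degree `n`. -/
structure TIdx (T : DGCat.{u, u, u} k) (n : ℤ) where
  z : T.Obj
  p : ℤ
  q : ℤ
  h : p + q = n

section
variable (X : DGFunctor T.op (DGCat.complexes.{u, u} k)) (M : DGFunctor T (DGCat.complexes.{u, u} k))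

open Classical in
/-- The pure tensors in the direct sum of all `X(z)ᵖ ⊗ M(z)^q` with `p + q = n`. -/
noncomputable def tpre (n : ℤ) (z : T.Obj) (p q : ℤ) (h : p + q = n) :
    (cx X z).X p →ₗ[k] (cx M z).X q →ₗ[k]
      (⨁ i : TIdx T n, ((cx X i.z).X i.p ⊗[k] (cx M i.z).X i.q)) :=
  (TensorProduct.mk k _ _).compr₂ (DirectSum.lof k (TIdx T n)
    (fun i => (cx X i.z).X i.p ⊗[k] (cx M i.z).X i.q) ⟨z, p, q, h⟩)

/-- The relations `X(f)(x) ⊗ m = (-1)^{|f||x|} x ⊗ M(f)(m)`. -/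
noncomputable def trel (n : ℤ) : Submodule k (⨁ i : TIdx T n, ((cx X i.z).X i.p ⊗[k] (cx M i.z).X i.q)) :=
  Submodule.span k {t | ∃ (a b : T.Obj) (r p q p' q' : ℤ) (hp : p + r = p') (hq : q + r = q')
    (h : p' + q = n) (h' : p + q' = n) (f : T.Hom a b r) (x : (cx X b).X p) (m : (cx M a).X q),
    t = tpre X M n a p' q h (act (A := T.op) X f p p' hp x) m -
      Int.negOnePow (p * r) • tpre X M n b p q' h' x (act M f q q' hq m)}

/-- The degree `n` part of `X ⊗_T M`. -/
def TDeg (n : ℤ) : Type u :=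
  (⨁ i : TIdx T n, ((cx X i.z).X i.p ⊗[k] (cx M i.z).X i.q)) ⧸ trel X M n

noncomputable instance (n : ℤ) : AddCommGroup (TDeg X M n) :=
  inferInstanceAs (AddCommGroup (_ ⧸ trel X M n))

noncomputable instance (n : ℤ) : Module k (TDeg X M n) :=
  inferInstanceAs (Module k (_ ⧸ trel X M n))

/-- Pure tensors. -/
noncomputable def tmk (n : ℤ) (z : T.Obj) (p q : ℤ) (h : p + q = n) :
    (cx X z).X p →ₗ[k] (cx M z).X q →ₗ[k] TDeg X M n :=
  (tpre X M n z p q h).compr₂ (trel X M n).mkQ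

variable {X M}

theorem tmk_act {n : ℤ} {a b : T.Obj} {r p q p' q' : ℤ} (hp : p + r = p') (hq : q + r = q')
    (h : p' + q = n) (h' : p + q' = n) (f : T.Hom a b r) (x : (cx X b).X p) (m : (cx M a).X q) :
    tmk X M n a p' q h (act (A := T.op) X f p p' hp x) m =
      Int.negOnePow (p * r) • tmk X M n b p q' h' x (act M f q q' hq m) := by
  have : (trel X M n).mkQ (tpre X M n a p' q h (act (A := T.op) X f p p' hp x) m -
      Int.negOnePow (p * r) • tpre X M n b p q' h' x (act M f q q' hq m)) = 0 :=
    (Submodule.Quotient.mk_eq_zero _).2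
      (Submodule.subset_span ⟨a, b, r, p, q, p', q', hp, hq, h, h', f, x, m, rfl⟩)
  rw [map_sub, map_sgn, sub_eq_zero] at this
  exact this

section lift
variable {n : ℤ} {V : Type u} [AddCommGroup V] [Module k V]
  (φ : ∀ (z : T.Obj) (p q : ℤ), p + q = n → ((cx X z).X p →ₗ[k] (cx M z).X q →ₗ[k] V))
  (H : ∀ (a b : T.Obj) (r p q p' q' : ℤ) (hp : p + r = p') (hq : q + r = q')
    (h : p' + q = n) (h' : p + q' = n) (f : T.Hom a b r) (x : (cx X b).X p) (m : (cx M a).X q),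
    φ a p' q h (act (A := T.op) X f p p' hp x) m =
      Int.negOnePow (p * r) • φ b p q' h' x (act M f q q' hq m))

open Classical in
/-- The universal property of the tensor product. -/
noncomputable def tlift : TDeg X M n →ₗ[k] V :=
  (trel X M n).liftQ (DirectSum.toModule k (TIdx T n) V
    (fun i => TensorProduct.lift (φ i.z i.p i.q i.h))) (by
      refine Submodule.span_le.2 ?_
      rintro _ ⟨a, b, r, p, q, p', q', hp, hq, h, h', f, x, m, rfl⟩
      rw [SetLike.mem_coe, LinearMap.mem_ker, map_sub, map_sgn, sub_eq_zero]
      simp only [tpre, LinearMap.compr₂_apply, DirectSum.toModule_lof, TensorProduct.mk_apply,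
        TensorProduct.lift.tmul]
      exact H a b r p q p' q' hp hq h h' f x m)

@[simp] theorem tlift_tmk (z : T.Obj) (p q : ℤ) (h : p + q = n) (x : (cx X z).X p)
    (m : (cx M z).X q) : tlift φ H (tmk X M n z p q h x m) = φ z p q h x m := by
  classical
  refine (Submodule.liftQ_apply _ _ _).trans ?_
  simp only [tpre, LinearMap.compr₂_apply, DirectSum.toModule_lof, TensorProduct.mk_apply,
    TensorProduct.lift.tmul]

end lift

theorem tdeg_ext {n : ℤ} {V : Type u} [AddCommGroup V] [Module k V] {f g : TDeg X M n →ₗ[k] V}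
    (H : ∀ z p q h x m, f (tmk X M n z p q h x m) = g (tmk X M n z p q h x m)) : f = g := by
  classical
  apply Submodule.linearMap_qext
  apply DirectSum.linearMap_ext
  rintro ⟨z, p, q, h⟩
  apply TensorProduct.ext'
  intro x m
  exact H z p q h x m

end

section complex
variable (X : DGFunctor T.op (DGCat.complexes.{u, u} k)) (M : DGFunctor T (DGCat.complexes.{u, u} k))

open Classical in
/-- The differential `d(x ⊗ m) = dx ⊗ m + (-1)^{|x|} x ⊗ dm`. -/
noncomputable def tdiff (n n' : ℤ) : TDeg X M n →ₗ[k] TDeg X M n' :=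
  if hn : n + 1 = n' then
    tlift (fun z p q h => (tmk X M n' z (p + 1) q (by omega)) ∘ₗ dd (cx X z) p (p + 1) +
      Int.negOnePow p • (tmk X M n' z p (q + 1) (by omega)).compl₂ (dd (cx M z) q (q + 1))) (by
        intro a b r p q p' q' hp hq h h' f x m
        simp only [LinearMap.add_apply, LinearMap.smul_apply, LinearMap.comp_apply,
          LinearMap.compl₂_apply]
        rw [act_d (A := T.op) f p p' (p + 1) (p' + 1) hp rfl rfl,
          act_d f q q' (q + 1) (q' + 1) hq rfl rfl, map_add, map_add, LinearMap.add_apply,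
          map_sgn, map_sgn, LinearMap.smul_apply]
        have e1 := tmk_act (X := X) (M := M) (n := n') (p' := p' + 1) (q' := q' + 1)
          (by omega : p + (r + 1) = p' + 1) (by omega) (by omega) (by omega) (T.d r (r + 1) f) x m
        have e2 := tmk_act (X := X) (M := M) (n := n') (p' := p' + 1) (q' := q')
          (by omega : (p + 1) + r = p' + 1) (by omega) (by omega) (by omega) f
          (dd (cx X b) p (p + 1) x) m
        have e3 := tmk_act (X := X) (M := M) (n := n') (p' := p') (q' := q' + 1)
          hp (by omega : q + 1 + r = q' + 1) (by omega) (by omega) f x (dd (cx M a) q (q + 1) m)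
        refine (congrArg₂ (· + ·) (congrArg₂ (· + ·) e1 (congrArg _ e2)) (congrArg _ e3)).trans ?_
        simp only [smul_add, smul_smul, ← Int.negOnePow_add]
        rw [sgn_congr (a := r + (p + 1) * r) (b := p * r) ⟨r, by ring⟩,
          sgn_congr (a := p * (r + 1)) (b := p * r + p) ⟨0, by ring⟩,
          sgn_congr (a := p' + p * r) (b := p * r + (p + r)) ⟨0, by rw [← hp]; ring⟩]
        abel)
  else 0

theorem tdiff_tmk {n n' : ℤ} (hn : n + 1 = n') (z : T.Obj) (p q p' q' : ℤ) (h : p + q = n)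
    (hp : p + 1 = p') (hq : q + 1 = q') (x : (cx X z).X p) (m : (cx M z).X q) :
    tdiff X M n n' (tmk X M n z p q h x m) =
      tmk X M n' z p' q (by omega) (dd (cx X z) p p' x) m +
      Int.negOnePow p • tmk X M n' z p q' (by omega) x (dd (cx M z) q q' m) := by
  subst hp hq
  rw [tdiff, dif_pos hn, tlift_tmk]
  rfl

/-- The complex `X ⊗_T M`. -/
noncomputable def tens : CochainComplex (ModuleCat.{u} k) ℤ where
  X n := ModuleCat.of k (TDeg X M n)
  d n n' := ModuleCat.ofHom (tdiff X M n n')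
  shape n n' h := by
    have : ¬ n + 1 = n' := h
    rw [tdiff, dif_neg this]
    rfl
  d_comp_d' n n' n'' h h' := by
    have h : n + 1 = n' := h
    have h' : n' + 1 = n'' := h'
    rw [← ModuleCat.ofHom_comp]
    refine congrArg ModuleCat.ofHom (tdeg_ext fun z p q hpq x m => ?_)
    rw [LinearMap.comp_apply, tdiff_tmk X M h z p q _ _ hpq rfl rfl, map_add, map_sgn,
      tdiff_tmk X M h' z _ _ (p + 1 + 1) (q + 1) _ rfl rfl,
      tdiff_tmk X M h' z _ _ (p + 1) (q + 1 + 1) _ rfl rfl, dd_dd, dd_dd]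
    simp [Int.negOnePow_succ]

end complex

section functoriality
variable {X X' : DGFunctor T.op (DGCat.complexes.{u, u} k)}
  {M M' : DGFunctor T (DGCat.complexes.{u, u} k)}

/-- `x ⊗ m ↦ φ(x) ⊗ m` in a fixed degree. -/
noncomputable def tmapL {c : ℤ} (φ : (RMod T).Hom X X' c)
    (M : DGFunctor T (DGCat.complexes.{u, u} k)) (i j : ℤ) (hij : i + c = j) :
    TDeg X M i →ₗ[k] TDeg X' M j :=
  tlift (fun z p q h => (tmk X' M j z (p + c) q (by omega)) ∘ₗ hap φ z p (p + c) rfl) (by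
    intro a b r p q p' q' hp hq h h' f x m
    subst hp
    simp only [LinearMap.comp_apply]
    have e := hap_nat φ f p (p + c) (p + r + c) (p + r) rfl (by omega) rfl rfl x
    have e' : hap φ a (p + r) (p + r + c) rfl (act (A := T.op) X f p (p + r) rfl x) =
        Int.negOnePow (c * r) • act (A := T.op) X' f (p + c) (p + r + c) (by omega)
          (hap φ b p (p + c) rfl x) := by
      rw [e, smul_smul, ← Int.negOnePow_add, sgn_congr (b := 0) ⟨c * r, by ring⟩]
      simp
    refine (congrArg (fun t => tmk X' M j a (p + r + c) q (by omega) t m) e').trans ?_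
    rw [map_sgn₂, tmk_act (q' := q') (by omega) hq (by omega) (by omega), smul_smul,
      ← Int.negOnePow_add]
    congr 1
    exact sgn_congr ⟨c * r, by ring⟩)

/-- `x ⊗ m ↦ (-1)^{|ψ||x|} x ⊗ ψ(m)` in a fixed degree. -/
noncomputable def tmapR (X : DGFunctor T.op (DGCat.complexes.{u, u} k)) {c : ℤ}
    (ψ : (LMod T).Hom M M' c) (i j : ℤ) (hij : i + c = j) : TDeg X M i →ₗ[k] TDeg X M' j :=
  tlift (fun z p q h => Int.negOnePow (c * p) •
      (tmk X M' j z p (q + c) (by omega)).compl₂ (hap ψ z q (q + c) rfl)) (by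
    intro a b r p q p' q' hp hq h h' f x m
    subst hq
    simp only [LinearMap.smul_apply, LinearMap.compl₂_apply]
    have e := hap_nat ψ f q (q + c) (q + r + c) (q + r) rfl (by omega) rfl rfl m
    have e' : hap ψ b (q + r) (q + r + c) rfl (act M f q (q + r) rfl m) =
        Int.negOnePow (c * r) • act M' f (q + c) (q + r + c) (by omega)
          (hap ψ a q (q + c) rfl m) := by
      rw [e, smul_smul, ← Int.negOnePow_add, sgn_congr (b := 0) ⟨c * r, by ring⟩]
      simp
    rw [e', map_sgn, tmk_act (q' := q + r + c) hp (by omega) (by omega) (by omega), smul_smul,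
      smul_smul, smul_smul, ← Int.negOnePow_add, ← Int.negOnePow_add, ← Int.negOnePow_add]
    congr 1
    exact sgn_congr ⟨0, by rw [← hp]; ring⟩)

/-- The graded map `φ ⊗ id`. -/
noncomputable def tensMapL {c : ℤ} (φ : (RMod T).Hom X X' c)
    (M : DGFunctor T (DGCat.complexes.{u, u} k)) : Cochain (tens X M) (tens X' M) c :=
  mkC (K := tens X M) (L := tens X' M) (tmapL φ M)

/-- The graded map `id ⊗ ψ`. -/
noncomputable def tensMapR (X : DGFunctor T.op (DGCat.complexes.{u, u} k)) {c : ℤ}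
    (ψ : (LMod T).Hom M M' c) : Cochain (tens X M) (tens X M') c :=
  mkC (K := tens X M) (L := tens X M') (tmapR X ψ)

theorem tmapL_tmk {c : ℤ} (φ : (RMod T).Hom X X' c) (i j : ℤ) (hij : i + c = j) (z : T.Obj)
    (p q p' : ℤ) (h : p + q = i) (hp : p + c = p') (x : (cx X z).X p) (m : (cx M z).X q) :
    tmapL φ M i j hij (tmk X M i z p q h x m) =
      tmk X' M j z p' q (by omega) (hap φ z p p' hp x) m := by
  subst hp
  rw [tmapL, tlift_tmk]
  rfl

theorem tmapR_tmk {c : ℤ} (ψ : (LMod T).Hom M M' c) (i j : ℤ) (hij : i + c = j) (z : T.Obj)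
    (p q q' : ℤ) (h : p + q = i) (hq : q + c = q') (x : (cx X z).X p) (m : (cx M z).X q) :
    tmapR X ψ i j hij (tmk X M i z p q h x m) =
      Int.negOnePow (c * p) • tmk X M' j z p q' (by omega) x (hap ψ z q q' hq m) := by
  subst hq
  rw [tmapR, tlift_tmk]
  rfl

/-- The composite of two maps of a tensor product in fixed degrees. -/
theorem mkC_comp {K L N : CochainComplex (ModuleCat.{u} k) ℤ} {a b c : ℤ} (h : a + b = c)
    (φ : ∀ i j : ℤ, i + a = j → (K.X i →ₗ[k] L.X j)) (ψ : ∀ i j : ℤ, i + b = j → (L.X i →ₗ[k] N.X j))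
    (χ : ∀ i j : ℤ, i + c = j → (K.X i →ₗ[k] N.X j))
    (H : ∀ i j l (h₁ : i + a = j) (h₂ : j + b = l) (h₃ : i + c = l), ψ j l h₂ ∘ₗ φ i j h₁ = χ i l h₃) :
    (mkC φ).comp (mkC ψ) h = mkC χ := by
  apply ap_ext
  intro i l hil x
  rw [ap_comp h _ _ i (i + a) l rfl (by omega) hil]
  exact congrArg (fun t => t x) (H i (i + a) l rfl (by omega) hil)

theorem mkC_d {K L : CochainComplex (ModuleCat.{u} k) ℤ} {n m : ℤ} (hm : n + 1 = m)
    (φ : ∀ i j : ℤ, i + n = j → (K.X i →ₗ[k] L.X j)) (ψ : ∀ i j : ℤ, i + m = j → (K.X i →ₗ[k] L.X j))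
    (H : ∀ i j i' j' (h : i + m = j) (_ : i + 1 = i') (hj : i + n = j') (hij : i' + n = j),
      dd L j' j ∘ₗ φ i j' hj - Int.negOnePow n • φ i' j hij ∘ₗ dd K i i' = ψ i j h) :
    δ n m (mkC φ) = mkC ψ := by
  apply ap_ext
  intro i j hij x
  rw [ap_d hm _ i j (i + 1) (i + n) hij rfl rfl (by omega)]
  exact congrArg (fun t => t x) (H i j (i + 1) (i + n) hij rfl rfl (by omega))

theorem mkC_id {K : CochainComplex (ModuleCat.{u} k) ℤ}
    (φ : ∀ i j : ℤ, i + 0 = j → (K.X i →ₗ[k] K.X j)) (H : ∀ i, φ i i (add_zero i) = LinearMap.id) :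
    mkC φ = Cochain.ofHom (𝟙 K) := by
  apply Cochain.ext₀
  intro i
  rw [Cochain.ofHom_v]
  exact congrArg ModuleCat.ofHom (H i)

theorem tmapR_add {c : ℤ} (f g : (LMod T).Hom M M' c) (i j : ℤ) (hij : i + c = j) :
    tmapR X (f + g) i j hij = tmapR X f i j hij + tmapR X g i j hij :=
  tdeg_ext fun z p q h x m => by
    rw [LinearMap.add_apply, tmapR_tmk _ i j hij z p q _ h rfl, tmapR_tmk _ i j hij z p q _ h rfl,
      tmapR_tmk _ i j hij z p q _ h rfl, ← smul_add, ← map_add]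
    rfl

theorem tmapR_smul {c : ℤ} (a : k) (f : (LMod T).Hom M M' c) (i j : ℤ) (hij : i + c = j) :
    tmapR X (a • f) i j hij = a • tmapR X f i j hij :=
  tdeg_ext fun z p q h x m => by
    rw [LinearMap.smul_apply, tmapR_tmk _ i j hij z p q _ h rfl,
      tmapR_tmk _ i j hij z p q _ h rfl]
    have e : hap (a • f) z q (q + c) rfl m = a • hap f z q (q + c) rfl m := rfl
    rw [e, map_smul, smul_comm]

theorem tmapR_id (i : ℤ) : tmapR X ((LMod T).id M) i i (add_zero i) = LinearMap.id :=
  tdeg_ext fun z p q hpq x v => by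
    rw [tmapR_tmk _ i i _ z p q q hpq (add_zero q)]
    have e : hap ((LMod T).id M) z q q (add_zero q) v = v :=
      congrArg (fun t => t.hom v) (Cochain.ofHom_v (𝟙 (cx M z)) q)
    rw [e]
    simp

theorem tmapR_comp {M'' : DGFunctor T (DGCat.complexes.{u, u} k)} {a b c : ℤ} (h : a + b = c)
    (f : (LMod T).Hom M M' a) (g : (LMod T).Hom M' M'' b) (i j l : ℤ) (h₁ : i + a = j)
    (h₂ : j + b = l) (h₃ : i + c = l) :
    tmapR X g j l h₂ ∘ₗ tmapR X f i j h₁ = tmapR X ((LMod T).comp h f g) i l h₃ :=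
  tdeg_ext fun z p q hpq x v => by
    rw [LinearMap.comp_apply, tmapR_tmk f i j h₁ z p q _ hpq rfl, map_sgn,
      tmapR_tmk g j l h₂ z p _ (q + c) (by omega) (by omega), tmapR_tmk _ i l h₃ z p q _ hpq rfl,
      smul_smul, ← Int.negOnePow_add]
    have e := ap_comp (K := cx M z) (L := cx M' z) (M := cx M'' z) h (f.1 z) (g.1 z) q (q + a)
      (q + c) rfl (by omega) rfl v
    refine congrArg₂ (· • ·) (sgn_congr ⟨0, by rw [← h]; ring⟩) (congrArg _ e.symm)

theorem tmapR_d {n m : ℤ} (hm : n + 1 = m) (f : (LMod T).Hom M M' n) (i j i' j' : ℤ)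
    (h : i + m = j) (hi : i + 1 = i') (hj : i + n = j') (hij : i' + n = j) :
    tdiff X M' j' j ∘ₗ tmapR X f i j' hj - Int.negOnePow n • tmapR X f i' j hij ∘ₗ tdiff X M i i' =
      tmapR X ((LMod T).d n m f) i j h :=
  tdeg_ext fun z p q hpq x v => by
    rw [LinearMap.sub_apply, LinearMap.smul_apply, LinearMap.comp_apply, LinearMap.comp_apply,
      tmapR_tmk _ i j' hj z p q _ hpq rfl, tdiff_tmk X M hi z p q _ _ hpq rfl rfl, map_add,
      map_sgn, map_sgn,
      tdiff_tmk X M' (by omega) z p (q + n) (p + 1) (q + m) (by omega) rfl (by omega),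
      tmapR_tmk _ i' j hij z (p + 1) q (q + n) (by omega) rfl,
      tmapR_tmk _ i' j hij z p (q + 1) (q + m) (by omega) (by omega),
      tmapR_tmk _ i j h z p q (q + m) hpq rfl,
      hap_d hm f z q (q + m) (q + 1) (q + n) rfl rfl rfl (by omega), map_sub, map_sgn]
    simp only [smul_add, smul_sub, smul_smul, ← Int.negOnePow_add]
    rw [sgn_congr (a := n + n * (p + 1)) (b := n * p) ⟨n, by ring⟩,
      sgn_congr (a := n * p + p) (b := m * p) ⟨0, by rw [← hm]; ring⟩,
      sgn_congr (a := n + (p + n * p)) (b := m * p + n) ⟨0, by rw [← hm]; ring⟩]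
    abel

/-- `X ⊗_T -` as a dg-functor. -/
noncomputable def tensL (X : (RMod T).Obj) :
    DGFunctor (LMod T) (DGCat.complexes.{u, u} k) where
  obj M := tens X M
  map {M M' n} :=
    { toFun := fun ψ => tensMapR X ψ
      map_add' := fun f g => ap_ext (K := tens X M) (L := tens X M') fun i j h x =>
        congrArg (fun t => t x) (tmapR_add f g i j h)
      map_smul' := fun c f => ap_ext (K := tens X M) (L := tens X M') fun i j h x =>
        congrArg (fun t => t x) (tmapR_smul c f i j h) }
  map_d {M M'} n m f := by
    by_cases hm : n + 1 = m
    swap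
    · rw [DGCat.d_shape _ n m hm, DGCat.d_shape _ n m hm, map_zero]
    exact (mkC_d (K := tens X M) (L := tens X M') hm (tmapR X f) (tmapR X ((LMod T).d n m f))
      (tmapR_d hm f)).symm
  map_id M := mkC_id (K := tens X M) (tmapR X ((LMod T).id M)) tmapR_id
  map_comp {M M' M''} a b c h f g :=
    (mkC_comp (K := tens X M) (L := tens X M') (N := tens X M'') h (tmapR X f) (tmapR X g)
      (tmapR X ((LMod T).comp h f g)) (tmapR_comp h f g)).symm

theorem tmapL_add {c : ℤ} (f g : (RMod T).Hom X X' c) (i j : ℤ) (hij : i + c = j) :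
    tmapL (f + g) M i j hij = tmapL f M i j hij + tmapL g M i j hij :=
  tdeg_ext fun z p q h x m => by
    rw [LinearMap.add_apply, tmapL_tmk _ i j hij z p q _ h rfl, tmapL_tmk _ i j hij z p q _ h rfl,
      tmapL_tmk _ i j hij z p q _ h rfl, ← LinearMap.add_apply, ← map_add]
    rfl

theorem tmapL_smul {c : ℤ} (a : k) (f : (RMod T).Hom X X' c) (i j : ℤ) (hij : i + c = j) :
    tmapL (a • f) M i j hij = a • tmapL f M i j hij :=
  tdeg_ext fun z p q h x m => by
    rw [LinearMap.smul_apply, tmapL_tmk _ i j hij z p q _ h rfl,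
      tmapL_tmk _ i j hij z p q _ h rfl, ← LinearMap.smul_apply, ← map_smul]
    rfl

theorem tmapL_id (i : ℤ) : tmapL ((RMod T).id X) M i i (add_zero i) = LinearMap.id :=
  tdeg_ext fun z p q hpq x v => by
    rw [tmapL_tmk _ i i _ z p q p hpq (add_zero p)]
    have e : hap ((RMod T).id X) z p p (add_zero p) x = x :=
      congrArg (fun t => t.hom x) (Cochain.ofHom_v (𝟙 (cx X z)) p)
    rw [e]
    rfl

theorem tmapL_comp {X'' : DGFunctor T.op (DGCat.complexes.{u, u} k)} {a b c : ℤ} (h : a + b = c)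
    (f : (RMod T).Hom X X' a) (g : (RMod T).Hom X' X'' b) (i j l : ℤ) (h₁ : i + a = j)
    (h₂ : j + b = l) (h₃ : i + c = l) :
    tmapL g M j l h₂ ∘ₗ tmapL f M i j h₁ = tmapL ((RMod T).comp h f g) M i l h₃ :=
  tdeg_ext fun z p q hpq x v => by
    rw [LinearMap.comp_apply, tmapL_tmk f i j h₁ z p q _ hpq rfl,
      tmapL_tmk g j l h₂ z _ q (p + c) (by omega) (by omega), tmapL_tmk _ i l h₃ z p q _ hpq rfl]
    have e := ap_comp (K := cx X z) (L := cx X' z) (M := cx X'' z) h (f.1 z) (g.1 z) p (p + a)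
      (p + c) rfl (by omega) rfl x
    exact congrArg (fun t => tmk X'' M l z (p + c) q (by omega) t v) e.symm

theorem tmapL_d {n m : ℤ} (hm : n + 1 = m) (f : (RMod T).Hom X X' n) (i j i' j' : ℤ)
    (h : i + m = j) (hi : i + 1 = i') (hj : i + n = j') (hij : i' + n = j) :
    tdiff X' M j' j ∘ₗ tmapL f M i j' hj - Int.negOnePow n • tmapL f M i' j hij ∘ₗ tdiff X M i i' =
      tmapL ((RMod T).d n m f) M i j h :=
  tdeg_ext fun z p q hpq x v => by
    rw [LinearMap.sub_apply, LinearMap.smul_apply, LinearMap.comp_apply, LinearMap.comp_apply,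
      tmapL_tmk _ i j' hj z p q _ hpq rfl, tdiff_tmk X M hi z p q _ _ hpq rfl rfl, map_add,
      map_sgn,
      tdiff_tmk X' M (by omega) z (p + n) q (p + m) (q + 1) (by omega) (by omega) rfl,
      tmapL_tmk _ i' j hij z (p + 1) q (p + m) (by omega) (by omega),
      tmapL_tmk _ i' j hij z p (q + 1) (p + n) (by omega) (by omega),
      tmapL_tmk _ i j h z p q (p + m) hpq rfl,
      hap_d hm f z p (p + m) (p + 1) (p + n) rfl rfl rfl (by omega), map_sub, map_sgn,
      LinearMap.sub_apply, LinearMap.smul_apply]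
    simp only [smul_add, smul_smul, ← Int.negOnePow_add]
    rw [sgn_congr (a := n + p) (b := p + n) ⟨0, by ring⟩]
    abel

theorem tmapL_tmapR {a b : ℤ} (f : (RMod T).Hom X X' a) (g : (LMod T).Hom M M' b)
    (i j j' l : ℤ) (h₁ : i + a = j) (h₂ : j + b = l) (h₃ : i + b = j') (h₄ : j' + a = l) :
    tmapR X' g j l h₂ ∘ₗ tmapL f M i j h₁ =
      Int.negOnePow (a * b) • tmapL f M' j' l h₄ ∘ₗ tmapR X g i j' h₃ :=
  tdeg_ext fun z p q hpq x v => by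
    rw [LinearMap.comp_apply, LinearMap.smul_apply, LinearMap.comp_apply,
      tmapL_tmk f i j h₁ z p q _ hpq rfl, tmapR_tmk g i j' h₃ z p q _ hpq rfl, map_sgn,
      tmapR_tmk g j l h₂ z _ q _ (by omega) rfl, tmapL_tmk f j' l h₄ z p _ _ (by omega) rfl,
      smul_smul, ← Int.negOnePow_add]
    congr 1
    exact sgn_congr ⟨0, by ring⟩

theorem tensMapL_nat {n p m : ℤ} (h : n + p = m) (h' : p + n = m) (φ : (RMod T).Hom X X' n)
    (g : (LMod T).Hom M M' p) :
    (tensMapL φ M).comp (tensMapR X' g) h =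
      Int.negOnePow (n * p) • (tensMapR X g).comp (tensMapL φ M') h' := by
  refine ap_ext (K := tens X M) (L := tens X' M') fun i l hil x => ?_
  have e1 := ap_comp (K := tens X M) (L := tens X' M) (M := tens X' M') h (tensMapL φ M)
    (tensMapR X' g) i (i + n) l rfl (by omega) hil x
  have e2 := ap_comp (K := tens X M) (L := tens X M') (M := tens X' M') h' (tensMapR X g)
    (tensMapL φ M') i (i + p) l rfl (by omega) hil x
  have e3 := congrArg (fun t => t x) (tmapL_tmapR φ g i (i + n) (i + p) l rfl (by omega) rfl
    (by omega))
  exact e1.trans (e3.trans (congrArg (fun t => Int.negOnePow (n * p) • t) e2.symm))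

theorem tensMapL_add {n : ℤ} (f g : (RMod T).Hom X X' n) :
    tensMapL (f + g) M = tensMapL f M + tensMapL g M :=
  ap_ext (K := tens X M) (L := tens X' M) fun i j h x =>
    congrArg (fun t => t x) (tmapL_add f g i j h)

theorem tensMapL_smul {n : ℤ} (c : k) (f : (RMod T).Hom X X' n) :
    tensMapL (c • f) M = c • tensMapL f M :=
  ap_ext (K := tens X M) (L := tens X' M) fun i j h x =>
    congrArg (fun t => t x) (tmapL_smul c f i j h)

theorem tensMapL_d {n m : ℤ} (hm : n + 1 = m) (f : (RMod T).Hom X X' n) :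
    tensMapL ((RMod T).d n m f) M = δ n m (tensMapL f M) :=
  (mkC_d (K := tens X M) (L := tens X' M) hm (tmapL f M)
    (tmapL ((RMod T).d n m f) M) (tmapL_d hm f)).symm

theorem tensMapL_id : tensMapL ((RMod T).id X) M = Cochain.ofHom (𝟙 (tens X M)) :=
  mkC_id (K := tens X M) (tmapL ((RMod T).id X) M) tmapL_id

theorem tensMapL_comp {X'' : DGFunctor T.op (DGCat.complexes.{u, u} k)} {a b c : ℤ} (h : a + b = c)
    (f : (RMod T).Hom X X' a) (g : (RMod T).Hom X' X'' b) :
    tensMapL ((RMod T).comp h f g) M = (tensMapL f M).comp (tensMapL g M) h :=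
  (mkC_comp (K := tens X M) (L := tens X' M) (N := tens X'' M) h (tmapL f M) (tmapL g M)
    (tmapL ((RMod T).comp h f g) M) (tmapL_comp h f g)).symm

/-- `φ ⊗ -` as a natural family. -/
noncomputable def tensLMap {n : ℤ} (φ : (RMod T).Hom X X' n) :
    ((LMod T).functors (DGCat.complexes.{u, u} k)).Hom (tensL X) (tensL X') n :=
  ⟨fun M => tensMapL φ M, fun _ _ _ _ h h' g => tensMapL_nat h h' φ g⟩

end functoriality

/-- The tensor product over `T`, as a dg-functor of the right module with values in dg-functors
of the left module. -/
noncomputable def tensor (T : DGCat.{u, u, u} k) :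
    DGFunctor (RMod T) ((LMod T).functors (DGCat.complexes.{u, u} k)) where
  obj X := tensL X
  map :=
    { toFun := tensLMap
      map_add' := fun f g => DGCat.functors_ext fun _ => tensMapL_add f g
      map_smul' := fun c f => DGCat.functors_ext fun _ => tensMapL_smul c f }
  map_d n m f := by
    by_cases hm : n + 1 = m
    · exact DGCat.functors_ext fun _ => tensMapL_d hm f
    · rw [DGCat.d_shape _ n m hm, DGCat.d_shape _ n m hm, map_zero]
  map_id _ := DGCat.functors_ext fun _ => tensMapL_id
  map_comp h f g := DGCat.functors_ext fun _ => tensMapL_comp h f g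

section canonical

theorem preMul_d_aux (T : DGCat.{u, u, u} k) {a b x : T.Obj} {n m i i' j j' : ℤ} (hm : n + 1 = m)
    (hi : i + 1 = i') (h₁ : n + i = j') (h₂ : n + i' = j) (h₃ : m + i = j) (f : T.Hom a b n)
    (e : T.Hom b x i) :
    T.d j' j (Int.negOnePow (n * i) • T.comp h₁ f e) -
      Int.negOnePow n • Int.negOnePow (n * i') • T.comp h₂ f (T.d i i' e) =
      Int.negOnePow (m * i) • T.comp h₃ (T.d n m f) e := by
  rw [map_sgn, T.d_comp h₁ hm hi h₂ h₃]
  simp only [smul_add, smul_smul, ← Int.negOnePow_add]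
  rw [sgn_congr (a := n + n * i') (b := n * i) ⟨n, by rw [← hi]; ring⟩,
    sgn_congr (a := n * i + i) (b := m * i) ⟨0, by rw [← hm]; ring⟩]
  exact add_sub_cancel_left _ _

theorem preMul_comp_aux (T : DGCat.{u, u, u} k) {a b c x : T.Obj} {p q n i j l : ℤ}
    (h : q + p = n) (h₁ : p + i = j) (h₂ : q + j = l) (h₃ : n + i = l)
    (f : T.Hom b c p) (g : T.Hom a b q) (e : T.Hom c x i) :
    Int.negOnePow (q * j) • T.comp h₂ g (Int.negOnePow (p * i) • T.comp h₁ f e) =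
      Int.negOnePow (n * i) • T.comp h₃ (Int.negOnePow (p * q) • T.comp h g f) e := by
  rw [map_sgn, map_sgn₂, T.assoc h h₃ h₁ h₂, smul_smul, smul_smul, ← Int.negOnePow_add,
    ← Int.negOnePow_add]
  congr 1
  exact sgn_congr ⟨0, by rw [← h₁, ← h]; ring⟩

theorem postMul_d_aux (T : DGCat.{u, u, u} k) {a b x : T.Obj} {n m i i' j j' : ℤ} (hm : n + 1 = m)
    (hi : i + 1 = i') (h₁ : i + n = j') (h₂ : i' + n = j) (h₃ : i + m = j) (e : T.Hom x a i)
    (f : T.Hom a b n) :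
    T.d j' j (T.comp h₁ e f) - Int.negOnePow n • T.comp h₂ (T.d i i' e) f =
      T.comp h₃ e (T.d n m f) := by
  rw [T.d_comp h₁ hi hm h₃ h₂]
  exact add_sub_cancel_right _ _

/-- `e ↦ (-1)^{|f||e|} e ∘ f` in a fixed degree. -/
noncomputable def preMul {z z' : T.Obj} {n : ℤ} (f : T.Hom z' z n) (x : T.Obj) (i j : ℤ)
    (h : i + n = j) : (T.homComplex z x).X i →ₗ[k] (T.homComplex z' x).X j :=
  (Int.negOnePow (n * i) • T.comp (by omega : n + i = j) f : T.Hom z x i →ₗ[k] T.Hom z' x j)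

/-- `e ↦ f ∘ e` in a fixed degree. -/
noncomputable def postMul {x x' : T.Obj} {n : ℤ} (f : T.Hom x x' n) (z : T.Obj) (i j : ℤ)
    (h : i + n = j) : (T.homComplex z x).X i →ₗ[k] (T.homComplex z x').X j :=
  ((T.comp h).flip f : T.Hom z x i →ₗ[k] T.Hom z x' j)

/-- The right module `T(-, x)`. -/
noncomputable def repMod (T : DGCat.{u, u, u} k) (x : T.Obj) : (RMod T).Obj where
  obj z := T.homComplex z x
  map {z z' n} :=
    { toFun := fun f => mkC (K := T.homComplex z x) (L := T.homComplex z' x) (preMul (T := T) f x)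
      map_add' := fun f g => ap_ext (K := T.homComplex z x) (L := T.homComplex z' x)
        fun i j h e => by
          have := congrArg (fun t => Int.negOnePow (n * i) • t e)
            (map_add (T.comp (x := z') (y := z) (z := x) (by omega : n + i = j)) f g)
          exact this.trans (smul_add _ _ _)
      map_smul' := fun c f => ap_ext (K := T.homComplex z x) (L := T.homComplex z' x)
        fun i j h e => by
          have := congrArg (fun t => Int.negOnePow (n * i) • t e)
            (map_smul (T.comp (x := z') (y := z) (z := x) (by omega : n + i = j)) c f)
          exact this.trans (smul_comm _ _ _) }
  map_d {z z'} n m f := by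
    by_cases hm : n + 1 = m
    swap
    · rw [DGCat.d_shape _ n m hm, DGCat.d_shape _ n m hm, map_zero]
    refine (mkC_d (K := T.homComplex z x) (L := T.homComplex z' x) hm (preMul (T := T) f x)
      (preMul (T := T) (T.d n m f) x) ?_).symm
    intro i j i' j' h hi hj hij
    ext e
    exact preMul_d_aux T hm hi (by omega) (by omega) (by omega) f e
  map_id z := by
    refine mkC_id (K := T.homComplex z x) (preMul (T := T) (T.id z) x) fun i => ?_
    ext e
    have : Int.negOnePow (0 * i) • T.comp (zero_add i) (T.id z) e = e := by
      simpa using T.id_comp e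
    exact this
  map_comp {z z' z'' p q n} h f g := by
    refine (mkC_comp (K := T.homComplex z x) (L := T.homComplex z' x)
      (N := T.homComplex z'' x) h (preMul (T := T) f x) (preMul (T := T) g x)
      (preMul (T := T) (T.op.comp h f g) x) ?_).symm
    intro i j l h₁ h₂ h₃
    ext e
    exact preMul_comp_aux T (by omega) (by omega) (by omega) (by omega) f g e

theorem comp_nat_aux (T : DGCat.{u, u, u} k) {a b x y : T.Obj} {p i n j l : ℤ} {i' : ℤ}
    (h₁ : p + j = l) (h₂ : i + n = j) (h₃ : i' + n = l) (h₄ : p + i = i') (f : T.Hom a b p)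
    (t : T.Hom b x i) (h : T.Hom x y n) :
    Int.negOnePow (p * j) • T.comp h₁ f (T.comp h₂ t h) =
      Int.negOnePow (n * p) • T.comp h₃ (Int.negOnePow (p * i) • T.comp h₄ f t) h := by
  rw [map_sgn₂, T.assoc h₄ h₃ h₂ h₁, smul_smul, ← Int.negOnePow_add]
  congr 1
  exact sgn_congr ⟨0, by rw [← h₂]; ring⟩

/-- The identity bimodule `x ↦ T(-, x)`. -/
noncomputable def idBimod (T : DGCat.{u, u, u} k) : DGFunctor T (RMod T) where
  obj := repMod T
  map {x x' n} :=
    { toFun := fun h => ⟨fun z => mkC (K := T.homComplex z x) (L := T.homComplex z x')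
          (postMul h z), fun z z' p m e e' f => by
        refine ap_ext (K := T.homComplex z x) (L := T.homComplex z' x') fun i l hil t => ?_
        refine (ap_comp (K := T.homComplex z x) (L := T.homComplex z x')
          (M := T.homComplex z' x') e _ _ i (i + n) l rfl (by omega) hil t).trans
          (Eq.trans ?_ (congrArg (fun s => Int.negOnePow (n * p) • s) (ap_comp
          (K := T.homComplex z x) (L := T.homComplex z' x)
          (M := T.homComplex z' x') e' _ _ i (i + p) l rfl (by omega) hil t).symm))
        exact comp_nat_aux T (by omega) rfl (by omega) (by omega) f t h⟩
      map_add' := fun f g => DGCat.functors_ext fun z => ap_ext (K := T.homComplex z x)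
        (L := T.homComplex z x') fun i j e t => by exact map_add (T.comp e t) _ _
      map_smul' := fun c f => DGCat.functors_ext fun z => ap_ext (K := T.homComplex z x)
        (L := T.homComplex z x') fun i j e t => by exact map_smul (T.comp e t) _ _ }
  map_d {x x'} n m f := by
    by_cases hm : n + 1 = m
    swap
    · rw [DGCat.d_shape _ n m hm, DGCat.d_shape _ n m hm, map_zero]
    refine DGCat.functors_ext fun z => 
      (mkC_d (K := T.homComplex z x) (L := T.homComplex z x') hm (postMul f z)
        (postMul (T.d n m f) z) ?_).symm
    intro i j i' j' h hi hj hij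
    ext e
    exact postMul_d_aux T hm hi _ _ _ e f
  map_id x := DGCat.functors_ext fun z =>
    mkC_id (K := T.homComplex z x) (postMul (T.id x) z) fun i => by
      ext e
      exact T.comp_id e
  map_comp {x x' x'' p q n} h f g := DGCat.functors_ext fun z => by
    refine (mkC_comp (K := T.homComplex z x) (L := T.homComplex z x')
      (N := T.homComplex z x'') h (postMul f z) (postMul g z) (postMul (T.comp h f g) z) ?_).symm
    intro i j l h₁ h₂ h₃
    ext e
    exact T.assoc _ _ _ _ _ _ _

/-- The action `f ⊗ m ↦ M(f)(m)` as a bilinear map. -/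
noncomputable def actBilin (M : (LMod T).Obj) (z x : T.Obj) (p q j : ℤ) (h : p + q = j) :
    T.Hom z x p →ₗ[k] (cx M z).X q →ₗ[k] (cx M x).X j :=
  LinearMap.mk₂ k (fun f m => act M f q j (by omega) m)
    (fun f g m => by unfold act; rw [map_add]; rfl)
    (fun c f m => by unfold act; rw [map_smul]; rfl)
    (fun f m m' => map_add _ _ _) (fun c f m => map_smul _ _ _)

theorem act_comp (M : (LMod T).Obj) {a b x : T.Obj} {r p n : ℤ} (h : r + p = n)
    (f : T.Hom a b r) (e : T.Hom b x p) (i j l : ℤ) (h₁ : i + r = j) (h₂ : j + p = l)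
    (h₃ : i + n = l) (m : (cx M a).X i) :
    act M (T.comp h f e) i l h₃ m = act M e j l h₂ (act M f i j h₁ m) := by
  have h1 := ap_comp (K := cx M a) (L := cx M b) (M := cx M x) h
    (M.map f) (M.map e) i j l h₁ h₂ h₃ m
  have h2 := M.map_comp h f e
  unfold act
  rw [h2]
  exact h1

/-- The isomorphism `T(-, x) ⊗_T M → M(x)`, `f ⊗ m ↦ M(f)(m)`. -/
noncomputable def unitMap (x : T.Obj) (M : (LMod T).Obj) :
    Cochain (tens (repMod T x) M) (cx M x) 0 :=
  mkC (K := tens (repMod T x) M) (L := cx M x) fun i j hij =>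
    tlift (X := repMod T x) (M := M) (fun z p q h => actBilin M z x p q j (by omega)) (by
      intro a b r p q p' q' hp hq h h' f e m
      have h3 : act (A := T.op) (repMod T x) f p p' hp e =
        Int.negOnePow (r * p) • T.comp (by omega : r + p = p') f (show T.Hom b x p from e) := rfl
      rw [mul_comm p r]
      refine (congrArg (fun t : T.Hom a x p' => actBilin M a x p' q j (by omega) t m) h3).trans ?_
      dsimp only
      rw [map_sgn₂]
      exact congrArg _ (act_comp M _ f e q q' j hq (by omega) (by omega) m))

end canonical

section exchange

section tri
variable {A B C D E : Type*} [AddCommGroup A] [AddCommGroup B] [AddCommGroup C] [AddCommGroup D]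
  [AddCommGroup E] [Module k A] [Module k B] [Module k C] [Module k D] [Module k E]

/-- `(a, b, c) ↦ ν(a, μ(b, c))`. -/
def tri (ν : A →ₗ[k] D →ₗ[k] E) (μ : B →ₗ[k] C →ₗ[k] D) : A →ₗ[k] B →ₗ[k] C →ₗ[k] E where
  toFun a := μ.compr₂ (ν a)
  map_add' a a' := by ext b c; simp
  map_smul' r a := by ext b c; simp

/-- `(b, c, a) ↦ ν(μ(a, b), c)`. -/
def tri' (ν : D →ₗ[k] C →ₗ[k] E) (μ : A →ₗ[k] B →ₗ[k] D) : B →ₗ[k] C →ₗ[k] A →ₗ[k] E where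
  toFun b := ν.flip.compl₂ (μ.flip b)
  map_add' a a' := by ext b c; simp
  map_smul' r a := by ext b c; simp

/-- `(a, b, c) ↦ ν(a, μ(c, b))`. -/
def tri'' (ν : A →ₗ[k] D →ₗ[k] E) (μ : C →ₗ[k] B →ₗ[k] D) : A →ₗ[k] B →ₗ[k] C →ₗ[k] E where
  toFun a := μ.flip.compr₂ (ν a)
  map_add' a a' := by ext b c; simp
  map_smul' r a := by ext b c; simp

end tri

/-- `X ⊗_T F`, contraction of `X` with the covariant variable of the bimodule `F`. -/
noncomputable def con (X : (RMod T).Obj) : DGFunctor (T.functors (RMod T)) (RMod T) :=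
  (DGFunctor.flipFunctor T T.op (DGCat.complexes.{u, u} k)).comp (DGFunctor.post T.op (tensL X))

/-- `F ⊗_T M`, contraction of `M` with the contravariant variable of the bimodule `F`. -/
noncomputable def tensBimod (F : DGFunctor T (RMod T)) (M : (LMod T).Obj) : (LMod T).Obj :=
  F.comp ((tensor T).comp (DGFunctor.ev (DGCat.complexes.{u, u} k) M))

variable (X : (RMod T).Obj) (F : DGFunctor T (RMod T)) (M : (LMod T).Obj)

/-- The left module `s ↦ F(s; t)`. -/
noncomputable abbrev slice (t : T.Obj) : (LMod T).Obj :=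
  F.comp (DGFunctor.ev (A := T.op) (DGCat.complexes.{u, u} k) t)

/-- `(x, f, m) ↦ x ⊗ (f ⊗ m)`. -/
noncomputable def assocIn (s t : T.Obj) (p₁ p₂ q r n : ℤ) (hr : p₂ + q = r) (h : p₁ + r = n) :
    (cx X s).X p₁ →ₗ[k] (cx (F.obj s) t).X p₂ →ₗ[k] (cx M t).X q →ₗ[k]
      TDeg X (tensBimod F M) n :=
  tri (tmk X (tensBimod F M) n s p₁ r h) (tmk (F.obj s) M r t p₂ q hr)

theorem assocIn_eq (s t : T.Obj) {p₁ p₂ q r r' n : ℤ} (hr : p₂ + q = r) (h : p₁ + r = n)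
    (hr' : p₂ + q = r') (h' : p₁ + r' = n) :
    assocIn X F M s t p₁ p₂ q r n hr h = assocIn X F M s t p₁ p₂ q r' n hr' h' := by
  subst hr hr'
  rfl

theorem assocIn_left {a b : T.Obj} (t : T.Obj) {p₁ p₂ q r n c p₁' p₂' r' : ℤ} (hr : p₂ + q = r)
    (h : p₁' + r = n) (h₁ : p₁ + c = p₁') (h₂ : p₂ + c = p₂') (hr' : p₂' + q = r') (h' : p₁ + r' = n)
    (f : T.Hom a b c) (x : (cx X b).X p₁) (y : (cx (F.obj a) t).X p₂) (m : (cx M t).X q) :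
    assocIn X F M a t p₁' p₂ q r n hr h (act (A := T.op) X f p₁ p₁' h₁ x) y m =
      Int.negOnePow (p₁ * c) • assocIn X F M b t p₁ p₂' q r' n hr' h' x
        (hap (F.map f) t p₂ p₂' h₂ y) m := by
  refine (tmk_act (X := X) (M := tensBimod F M) h₁ (by omega : r + c = r') h h' f x
    (tmk (F.obj a) M r t p₂ q hr y m)).trans (congrArg _ (congrArg _ ?_))
  exact tmapL_tmk (F.map f) r r' (by omega) t p₂ q p₂' hr h₂ y m

theorem assocIn_right (s : T.Obj) {a b : T.Obj} {p₁ p₂ q n c p₂' q' r : ℤ} (hr : p₂' + q = r)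
    (h : p₁ + r = n) (h₁ : p₂ + c = p₂') (h₂ : q + c = q') (hr' : p₂ + q' = r)
    (f : T.Hom a b c) (x : (cx X s).X p₁) (y : (cx (F.obj s) b).X p₂) (m : (cx M a).X q) :
    assocIn X F M s a p₁ p₂' q r n hr h x (act (A := T.op) (F.obj s) f p₂ p₂' h₁ y) m =
      Int.negOnePow (p₂ * c) • assocIn X F M s b p₁ p₂ q' r n hr' h x y (act M f q q' h₂ m) := by
  refine (congrArg (tmk X (tensBimod F M) n s p₁ r h x) (tmk_act (X := F.obj s) (M := M) h₁ h₂
    hr hr' f y m)).trans ?_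
  exact map_sgn _ _ _

/-- `(x ⊗ f, m) ↦ x ⊗ (f ⊗ m)` in a fixed degree. -/
noncomputable def assocMid (t : T.Obj) (p q n : ℤ) (h : p + q = n) :
    TDeg X (slice F t) p →ₗ[k] (cx M t).X q →ₗ[k] TDeg X (tensBimod F M) n :=
  tlift (X := X) (M := slice F t)
    (fun s p₁ p₂ h' => assocIn X F M s t p₁ p₂ q (p₂ + q) n rfl (by omega)) (by
    intro a b r p₁ p₂ p₁' p₂' h₁ h₂ h₃ h₄ f x y
    ext m
    exact assocIn_left X F M t rfl (by omega) h₁ h₂ rfl (by omega) f x y m)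

theorem assocMid_tmk (t s : T.Obj) {p q n p₁ p₂ r : ℤ} (h : p + q = n) (h' : p₁ + p₂ = p)
    (hr : p₂ + q = r) (h'' : p₁ + r = n) (x : (cx X s).X p₁) (f : (cx (F.obj s) t).X p₂)
    (m : (cx M t).X q) :
    assocMid X F M t p q n h (tmk X (slice F t) p s p₁ p₂ h' x f) m =
      assocIn X F M s t p₁ p₂ q r n hr h'' x f m := by
  subst hr
  exact DFunLike.congr_fun (tlift_tmk (X := X) (M := slice F t)
    (fun s p₁ p₂ h' => assocIn X F M s t p₁ p₂ q (p₂ + q) n rfl (by omega)) _ s p₁ p₂ h' x f) m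

/-- The isomorphism `(X ⊗_T F) ⊗_T M → X ⊗_T (F ⊗_T M)`, `(x ⊗ f) ⊗ m ↦ x ⊗ (f ⊗ m)`. -/
noncomputable def assocHom :
    Cochain (tens ((con X).obj F) M) (tens X (tensBimod F M)) 0 :=
  mkC (K := tens ((con X).obj F) M) (L := tens X (tensBimod F M)) fun i j hij =>
    tlift (X := (con X).obj F) (M := M)
      (fun t p q h => assocMid X F M t p q j (by omega)) (by
      intro a b c p q p' q' hp hq h h' f y m
      have key : (assocMid X F M a p' q j (by omega)).flip m ∘ₗ
            tmapR X (F.flip.map f) p p' hp =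
          Int.negOnePow (p * c) • (assocMid X F M b p q' j (by omega)).flip
            (act M f q q' hq m) := by
        refine tdeg_ext fun s p₁ p₂ h₁ x e => ?_
        have e1 := tmapR_tmk (X := X) (F.flip.map f) p p' hp s p₁ p₂ (p₂ + c) h₁ rfl x e
        have e2 := assocMid_tmk X F M a s (by omega : p' + q = j) (by omega : p₁ + (p₂ + c) = p')
          (by omega) (by omega : p₁ + (p₂ + c + q) = j) x
          (act (A := T.op) (F.obj s) f p₂ (p₂ + c) rfl e) m
        have e3 := assocMid_tmk X F M b s (by omega : p + q' = j) h₁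
          (by omega : p₂ + q' = p₂ + c + q) (by omega : p₁ + (p₂ + c + q) = j) x e (act M f q q' hq m)
        have e4 := assocIn_right X F M s (n := j) (r := p₂ + c + q) rfl (by omega) rfl hq (by omega) f x e m
        refine (congrArg (fun t => assocMid X F M a p' q j (by omega) t m) e1).trans ?_
        refine (map_sgn₂ (assocMid X F M a p' q j (by omega)) _ _ m).trans ?_
        refine (congrArg _ (e2.trans e4)).trans ?_
        refine Eq.trans ?_ (congrArg (fun t => Int.negOnePow (p * c) • t) e3.symm)
        rw [smul_smul, ← Int.negOnePow_add]
        congr 1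
        exact sgn_congr ⟨0, by rw [← h₁]; ring⟩
      exact congrArg (fun t => t y) key)

/-- `(f, m, x) ↦ (x ⊗ f) ⊗ m`. -/
noncomputable def assocInvIn (s t : T.Obj) (p₁ p₂ q r n : ℤ) (hr : p₁ + p₂ = r) (h : r + q = n) :
    (cx (F.obj s) t).X p₂ →ₗ[k] (cx M t).X q →ₗ[k] (cx X s).X p₁ →ₗ[k]
      TDeg ((con X).obj F) M n :=
  tri' (tmk ((con X).obj F) M n t r q h) (tmk X (slice F t) r s p₁ p₂ hr)

theorem assocInvIn_right (s : T.Obj) {a b : T.Obj} {p₁ p₂ q r n c p₂' q' r' : ℤ}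
    (hr : p₁ + p₂' = r) (h : r + q = n) (h₁ : p₂ + c = p₂') (h₂ : q + c = q')
    (hr' : p₁ + p₂ = r') (h' : r' + q' = n)
    (f : T.Hom a b c) (y : (cx (F.obj s) b).X p₂) (m : (cx M a).X q) (x : (cx X s).X p₁) :
    assocInvIn X F M s a p₁ p₂' q r n hr h (act (A := T.op) (F.obj s) f p₂ p₂' h₁ y) m x =
      Int.negOnePow (p₂ * c) • assocInvIn X F M s b p₁ p₂ q' r' n hr' h' y (act M f q q' h₂ m) x := by
  have e1 := tmapR_tmk (X := X) (F.flip.map f) r' r (by omega) s p₁ p₂ p₂' hr' h₁ x y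
  have e2 := tmk_act (X := (con X).obj F) (M := M) (by omega : r' + c = r) h₂ h h' f
    (tmk X (slice F b) r' s p₁ p₂ hr' x y) m
  have e3 := (congrArg (fun t => tmk ((con X).obj F) M n a r q h t m) e1).symm.trans e2
  have e4 := (map_sgn₂ (tmk ((con X).obj F) M n a r q h) _ _ m).symm.trans e3
  have e5 := congrArg (fun t => Int.negOnePow (c * p₁) • t) e4
  rw [smul_smul, smul_smul, ← Int.negOnePow_add, ← Int.negOnePow_add,
    sgn_congr (a := c * p₁ + c * p₁) (b := 0) ⟨c * p₁, by ring⟩, Int.negOnePow_zero, one_smul,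
    sgn_congr (a := c * p₁ + r' * c) (b := p₂ * c) ⟨c * p₁, by rw [← hr']; ring⟩] at e5
  exact e5

theorem assocInvIn_left {a b : T.Obj} (t : T.Obj) {p₁ p₂ q r n c p₁' p₂' : ℤ} (hr : p₁' + p₂ = r)
    (h : r + q = n) (h₁ : p₁ + c = p₁') (h₂ : p₂ + c = p₂') (hr' : p₁ + p₂' = r)
    (f : T.Hom a b c) (x : (cx X b).X p₁) (y : (cx (F.obj a) t).X p₂) (m : (cx M t).X q) :
    assocInvIn X F M a t p₁' p₂ q r n hr h y m (act (A := T.op) X f p₁ p₁' h₁ x) =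
      Int.negOnePow (p₁ * c) • assocInvIn X F M b t p₁ p₂' q r n hr' h
        (hap (F.map f) t p₂ p₂' h₂ y) m x := by
  refine (congrArg (fun e => tmk ((con X).obj F) M n t r q h e m) (tmk_act (X := X)
    (M := slice F t) h₁ h₂ hr hr' f x y)).trans ?_
  exact map_sgn₂ (tmk ((con X).obj F) M n t r q h) _ _ m

/-- `(f ⊗ m, x) ↦ (x ⊗ f) ⊗ m` in a fixed degree. -/
noncomputable def assocInvMid (s : T.Obj) (p q n : ℤ) (h : p + q = n) :
    TDeg (F.obj s) M q →ₗ[k] (cx X s).X p →ₗ[k] TDeg ((con X).obj F) M n :=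
  tlift (X := F.obj s) (M := M)
    (fun t p₂ q h' => assocInvIn X F M s t p p₂ q (p + p₂) n rfl (by omega)) (by
    intro a b c p₁ p₂ p₁' p₂' h₁ h₂ h₃ h₄ f y m
    ext x
    exact assocInvIn_right X F M s rfl (by omega) h₁ h₂ rfl (by omega) f y m x)

theorem assocInvMid_tmk (s t : T.Obj) {p r n p₂ q u : ℤ} (h : p + r = n) (h' : p₂ + q = r)
    (hu : p + p₂ = u) (h'' : u + q = n) (f : (cx (F.obj s) t).X p₂) (m : (cx M t).X q)
    (x : (cx X s).X p) :
    assocInvMid X F M s p r n h (tmk (F.obj s) M r t p₂ q h' f m) x =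
      assocInvIn X F M s t p p₂ q u n hu h'' f m x := by
  subst hu
  exact DFunLike.congr_fun (tlift_tmk (X := F.obj s) (M := M)
    (fun t p₂ q h' => assocInvIn X F M s t p p₂ q (p + p₂) n rfl (by omega)) _ t p₂ q h' f m) x

/-- The isomorphism `X ⊗_T (F ⊗_T M) → (X ⊗_T F) ⊗_T M`, `x ⊗ (f ⊗ m) ↦ (x ⊗ f) ⊗ m`. -/
noncomputable def assocInv :
    Cochain (tens X (tensBimod F M)) (tens ((con X).obj F) M) 0 :=
  mkC (K := tens X (tensBimod F M)) (L := tens ((con X).obj F) M) fun i j hij =>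
    tlift (X := X) (M := tensBimod F M)
      (fun s p q h => (assocInvMid X F M s p q j (by omega)).flip) (by
      intro a b c p q p' q' hp hq h h' f x y
      have key : (assocInvMid X F M a p' q j (by omega)).flip
            (act (A := T.op) X f p p' hp x) =
          Int.negOnePow (p * c) • (assocInvMid X F M b p q' j (by omega)).flip x ∘ₗ
            tmapL (F.map f) M q q' hq := by
        refine tdeg_ext fun t p₂ r h₁ y m => ?_
        have e1 := tmapL_tmk (M := M) (F.map f) q q' hq t p₂ r (p₂ + c) h₁ rfl y m
        have e2 := assocInvMid_tmk X F M a t (by omega : p' + q = j) h₁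
          (by omega : p' + p₂ = p' + p₂) (by omega) y m (act (A := T.op) X f p p' hp x)
        have e3 := assocInvMid_tmk X F M b t (by omega : p + q' = j)
          (by omega : p₂ + c + r = q') (by omega : p + (p₂ + c) = p' + p₂) (by omega)
          (hap (F.map f) t p₂ (p₂ + c) rfl y) m x
        have e4 := assocInvIn_left X F M t (n := j) (by omega : p' + p₂ = p' + p₂) (by omega) hp rfl
          (by omega) f x y m
        refine (e2.trans e4).trans (congrArg (fun t => Int.negOnePow (p * c) • t) ?_)
        exact e3.symm.trans
          (congrArg (fun t => assocInvMid X F M b p q' j (by omega) t x) e1.symm)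
      exact congrArg (fun t => t y) key)

variable (Y : (RMod T).Obj) (G : DGFunctor T (LMod T))

/-- `(x, g, y) ↦ (-1)^{|x||y|} x ⊗ (y ⊗ g)`. -/
noncomputable def swapIn (s t : T.Obj) (p₁ p₂ q r n : ℤ) (hr : q + p₂ = r) (h : p₁ + r = n) :
    (cx X s).X p₁ →ₗ[k] (cx (G.obj s) t).X p₂ →ₗ[k] (cx Y t).X q →ₗ[k]
      TDeg X (G.comp (tensL Y)) n :=
  Int.negOnePow (p₁ * q) • tri'' (tmk X (G.comp (tensL Y)) n s p₁ r h)
    (tmk Y (G.obj s) r t q p₂ hr)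

theorem swapIn_left {a b : T.Obj} (t : T.Obj) {p₁ p₂ q r n c p₁' p₂' r' : ℤ} (hr : q + p₂ = r)
    (h : p₁' + r = n) (h₁ : p₁ + c = p₁') (h₂ : p₂ + c = p₂') (hr' : q + p₂' = r')
    (h' : p₁ + r' = n) (f : T.Hom a b c) (x : (cx X b).X p₁) (g : (cx (G.obj a) t).X p₂)
    (y : (cx Y t).X q) :
    swapIn X Y G a t p₁' p₂ q r n hr h (act (A := T.op) X f p₁ p₁' h₁ x) g y =
      Int.negOnePow (p₁ * c) • swapIn X Y G b t p₁ p₂' q r' n hr' h' x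
        (hap (G.map f) t p₂ p₂' h₂ g) y := by
  have e1 := tmk_act (X := X) (M := G.comp (tensL Y)) h₁ (by omega : r + c = r') h h' f x
    (tmk Y (G.obj a) r t q p₂ hr y g)
  have e2 := tmapR_tmk (X := Y) (G.map f) r r' (by omega) t q p₂ p₂' hr h₂ y g
  have e3 := (congrArg (tmk X (G.comp (tensL Y)) n b p₁ r' h' x) e2).trans (map_sgn _ _ _)
  have e4 := e1.trans (congrArg (fun t => Int.negOnePow (p₁ * c) • t) e3)
  refine (congrArg (fun t => Int.negOnePow (p₁' * q) • t) e4).trans ?_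
  change _ = Int.negOnePow (p₁ * c) • Int.negOnePow (p₁ * q) •
    (tmk X (G.comp (tensL Y)) n b p₁ r' h' x)
      (tmk Y (G.obj b) r' t q p₂' hr' y (hap (G.map f) t p₂ p₂' h₂ g))
  rw [smul_smul, smul_smul, smul_smul, ← Int.negOnePow_add, ← Int.negOnePow_add,
    ← Int.negOnePow_add]
  congr 1
  exact sgn_congr ⟨c * q, by rw [← h₁]; ring⟩

theorem swapIn_right (s : T.Obj) {a b : T.Obj} {p₁ p₂ q r n c p₂' q' : ℤ} (hr : q' + p₂ = r)
    (h : p₁ + r = n) (h₁ : q + c = q') (h₂ : p₂ + c = p₂') (hr' : q + p₂' = r)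
    (f : T.Hom a b c) (x : (cx X s).X p₁) (g : (cx (G.obj s) a).X p₂) (y : (cx Y b).X q) :
    swapIn X Y G s a p₁ p₂ q' r n hr h x g (act (A := T.op) Y f q q' h₁ y) =
      Int.negOnePow (q * c + c * p₁) • swapIn X Y G s b p₁ p₂' q r n hr' h x
        (act (G.obj s) f p₂ p₂' h₂ g) y := by
  have e1 := tmk_act (X := Y) (M := G.obj s) h₁ h₂ hr hr' f y g
  have e2 := (congrArg (tmk X (G.comp (tensL Y)) n s p₁ r h x) e1).trans (map_sgn _ _ _)
  refine (congrArg (fun t => Int.negOnePow (p₁ * q') • t) e2).trans ?_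
  change _ = Int.negOnePow (q * c + c * p₁) • Int.negOnePow (p₁ * q) •
    (tmk X (G.comp (tensL Y)) n s p₁ r h x)
      (tmk Y (G.obj s) r b q p₂' hr' y (act (G.obj s) f p₂ p₂' h₂ g))
  rw [smul_smul, smul_smul, ← Int.negOnePow_add, ← Int.negOnePow_add]
  congr 1
  exact sgn_congr ⟨0, by rw [← h₁]; ring⟩

/-- `(x ⊗ g, y) ↦ (-1)^{|x||y|} x ⊗ (y ⊗ g)` in a fixed degree. -/
noncomputable def swapMid (t : T.Obj) (p q n : ℤ) (h : p + q = n) :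
    TDeg X (G.flip.obj t) p →ₗ[k] (cx Y t).X q →ₗ[k] TDeg X (G.comp (tensL Y)) n :=
  tlift (X := X) (M := G.flip.obj t)
    (fun s p₁ p₂ h' => swapIn X Y G s t p₁ p₂ q (q + p₂) n rfl (by omega)) (by
    intro a b c p₁ p₂ p₁' p₂' h₁ h₂ h₃ h₄ f x g
    ext y
    exact swapIn_left X Y G t rfl (by omega) h₁ h₂ rfl (by omega) f x g y)

theorem swapMid_tmk (s t : T.Obj) {p q n p₁ p₂ r : ℤ} (h : p + q = n) (h' : p₁ + p₂ = p)
    (hr : q + p₂ = r) (h'' : p₁ + r = n) (x : (cx X s).X p₁) (g : (cx (G.obj s) t).X p₂)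
    (y : (cx Y t).X q) :
    swapMid X Y G t p q n h (tmk X (G.flip.obj t) p s p₁ p₂ h' x g) y =
      swapIn X Y G s t p₁ p₂ q r n hr h'' x g y := by
  subst hr
  exact DFunLike.congr_fun (tlift_tmk (X := X) (M := G.flip.obj t)
    (fun s p₁ p₂ h' => swapIn X Y G s t p₁ p₂ q (q + p₂) n rfl (by omega)) _ s p₁ p₂ h' x g) y

/-- The isomorphism `Y ⊗_T (X ⊗_T G) → X ⊗_T (Y ⊗_T G)`,
`y ⊗ (x ⊗ g) ↦ (-1)^{|x||y|} x ⊗ (y ⊗ g)`, where `X` is contracted with the first and `Y` with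
the second variable of `G`. -/
noncomputable def swapHom :
    Cochain (tens Y (G.flip.comp (tensL X))) (tens X (G.comp (tensL Y))) 0 :=
  mkC (K := tens Y (G.flip.comp (tensL X))) (L := tens X (G.comp (tensL Y))) fun i j hij =>
    tlift (X := Y) (M := G.flip.comp (tensL X))
      (fun t q p h => (swapMid X Y G t p q j (by omega)).flip) (by
      intro a b c q p q' p' hq hp h h' f y ξ
      have key : (swapMid X Y G a p q' j (by omega)).flip
            (act (A := T.op) Y f q q' hq y) =
          Int.negOnePow (q * c) • (swapMid X Y G b p' q j (by omega)).flip y ∘ₗ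
            tmapR X (G.flip.map f) p p' hp := by
        refine tdeg_ext fun s p₁ p₂ h₁ x g => ?_
        have e1 := tmapR_tmk (X := X) (G.flip.map f) p p' hp s p₁ p₂ (p₂ + c) h₁ rfl x g
        have e2 := swapMid_tmk X Y G s a (by omega : p + q' = j) h₁
          (by omega : q' + p₂ = q' + p₂) (by omega) x g (act (A := T.op) Y f q q' hq y)
        have e3 := swapMid_tmk X Y G s b (by omega : p' + q = j)
          (by omega : p₁ + (p₂ + c) = p') (by omega : q + (p₂ + c) = q' + p₂) (by omega) x
          (act (G.obj s) f p₂ (p₂ + c) rfl g) y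
        have e4 := swapIn_right X Y G s (n := j) (by omega : q' + p₂ = q' + p₂) (by omega) hq rfl
          (by omega) f x g y
        have e5 := (congrArg (fun t => swapMid X Y G b p' q j (by omega) t y) e1).trans
          (map_sgn₂ (swapMid X Y G b p' q j (by omega)) _ _ y)
        have e6 := e5.trans (congrArg (fun t => Int.negOnePow (c * p₁) • t) e3)
        refine (e2.trans e4).trans ?_
        refine Eq.trans ?_ (congrArg (fun t => Int.negOnePow (q * c) • t) e6.symm)
        rw [smul_smul, ← Int.negOnePow_add]
      exact congrArg (fun t => t ξ) key)

end exchange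

section iterated

variable {D : DGCat.{u, u + 1, u} k} (Γ : DGFunctor T (T.functors D))
  (P Q : DGFunctor D (T.functors D)) (U : D.Obj)

/-- Given `Γ(x, y)` and the extension `P : Z ↦ (x ↦ Γ(x, Z))` of its second variable, this is
`(y, z, x) ↦ Γ(x, Γ(y, z))`. -/
def rightRot₃ : DGFunctor T (T.functors (T.functors D)) := Γ.comp (DGFunctor.post T P)

/-- `(x, y, z) ↦ Γ(x, Γ(y, z))`. -/
def right₃ : DGFunctor T (T.functors (T.functors D)) :=
  ((rightRot₃ Γ P).comp (DGFunctor.flipFunctor T T D)).flip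

/-- Given `Γ(x, y)` and the extension `Q : Z ↦ (y ↦ Γ(Z, y))` of its first variable, this is
`(x, y, z) ↦ Γ(Γ(x, y), z)`. -/
def left₃ : DGFunctor T (T.functors (T.functors D)) := Γ.comp (DGFunctor.post T Q)

/-- `(x, y, z) ↦ Γ(Γ(z, x), y)`. -/
def leftRot₃ : DGFunctor T (T.functors (T.functors D)) :=
  (left₃ Γ Q).flip.comp (DGFunctor.flipFunctor T T D)

/-- `(y, z, w, x) ↦ Γ(x, Γ(y, Γ(z, w)))`. -/
def rightRot₄ : DGFunctor T (T.functors (T.functors (T.functors D))) :=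
  (right₃ Γ P).comp (DGFunctor.post T (DGFunctor.post T P))

/-- `(y, z, x, w) ↦ Γ(x, Γ(y, Γ(z, w)))`. -/
def rightSwap₄ : DGFunctor T (T.functors (T.functors (T.functors D))) :=
  (rightRot₄ Γ P).comp (DGFunctor.post T (DGFunctor.flipFunctor T T D))

/-- `(x, y, z, w) ↦ Γ(x, Γ(y, Γ(z, w)))`. -/
def right₄ : DGFunctor T (T.functors (T.functors (T.functors D))) :=
  ((rightSwap₄ Γ P).comp (DGFunctor.flipFunctor T T (T.functors D))).flip

/-- `(x, y, z, w) ↦ Γ(Γ(Γ(x, y), z), w)`. -/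
def left₄ : DGFunctor T (T.functors (T.functors (T.functors D))) :=
  (left₃ Γ Q).comp (DGFunctor.post T (DGFunctor.post T Q))

/-- `(x, y) ↦ Γ(x, Γ(U, y))`. -/
def rightUnit₂ : DGFunctor T (T.functors D) := ((Q.obj U).comp P).flip

end iterated

/-- Left-right bimodules: dg-functors `T → Tᵒᵖ-Mod`. -/
noncomputable abbrev Bimod₁ (T : DGCat.{u, u, u} k) : DGCat.{u, u + 1, u} k := T.functors (RMod T)

/-- Twofold bimodules, covariant in two variables and contravariant in the last one. -/
noncomputable abbrev Bimod₂ (T : DGCat.{u, u, u} k) : DGCat.{u, u + 1, u} k :=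
  T.functors (T.functors (RMod T))

/-- Threefold bimodules. -/
noncomputable abbrev Bimod₃ (T : DGCat.{u, u, u} k) : DGCat.{u, u + 1, u} k :=
  T.functors (T.functors (T.functors (RMod T)))

/-- Fourfold bimodules. -/
noncomputable abbrev Bimod₄ (T : DGCat.{u, u, u} k) : DGCat.{u, u + 1, u} k :=
  T.functors (T.functors (T.functors (T.functors (RMod T))))

section extension

/-- Pointwise tensor product: a right module `X` and a family `w ↦ N(w)` of left modules,
contravariant in `w`, give the right module `w ↦ X ⊗_T N(w)`. -/
noncomputable def actF (T : DGCat.{u, u, u} k) :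
    DGFunctor (RMod T) ((T.op.functors (LMod T)).functors (RMod T)) :=
  (tensor T).comp (DGFunctor.postFunctor T.op (LMod T) (DGCat.complexes.{u, u} k))

variable (Γ : DGFunctor T (T.functors (RMod T)))

/-- `X ↦ (y ↦ Γ(X, y))`, where `Γ(X, y; w) = X ⊗_s Γ(s, y; w)`. -/
noncomputable def plugFst : DGFunctor (RMod T) (T.functors (RMod T)) :=
  (actF T).comp (DGFunctor.pre
    (Γ.flip.comp (DGFunctor.flipFunctor T T.op (DGCat.complexes.{u, u} k))) (RMod T))

/-- `X ↦ (x ↦ Γ(x, X))`, where `Γ(x, X; w) = X ⊗_t Γ(x, t; w)`. -/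
noncomputable def plugSnd : DGFunctor (RMod T) (T.functors (RMod T)) :=
  (actF T).comp (DGFunctor.pre
    (Γ.comp (DGFunctor.flipFunctor T T.op (DGCat.complexes.{u, u} k))) (RMod T))

/-- The left module `s ↦ Γ(s, y; w)`. -/
noncomputable abbrev sliceFst (y w : T.Obj) : DGFunctor T (DGCat.complexes.{u, u} k) :=
  slice (Γ.flip.obj y) w

/-- The left module `t ↦ Γ(x, t; w)`. -/
noncomputable abbrev sliceSnd (x w : T.Obj) : DGFunctor T (DGCat.complexes.{u, u} k) :=
  slice (Γ.obj x) w
end extension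

section coherence

variable (Γ : DGFunctor T (T.functors (RMod T))) (U : DGFunctor T.op (DGCat.complexes.{u, u} k))

/-- The morphisms `Γ(x, Γ(y, z)) → Γ(Γ(x, y), z)` of degree zero. -/
abbrev Associator : Type u :=
  (Bimod₃ T).Hom (right₃ Γ (plugSnd Γ)) (left₃ Γ (plugFst Γ)) 0

/-- The morphisms `Γ(U, y) → T(-, y)` of degree zero. -/
abbrev LeftUnitor : Type u := (Bimod₁ T).Hom ((plugFst Γ).obj U) (idBimod T) 0

/-- The morphisms `Γ(x, U) → T(-, x)` of degree zero. -/
abbrev RightUnitor : Type u := (Bimod₁ T).Hom ((plugSnd Γ).obj U) (idBimod T) 0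

/-- The morphisms `Γ(x, y) → Γ(y, x)` of degree zero. -/
abbrev Braiding : Type u := (Bimod₂ T).Hom Γ Γ.flip 0

/-- Restriction of a morphism of twofold bimodules to a fixed second variable. -/
def fixSnd {D : DGCat.{u, u + 1, u} k} (y : T.Obj) {F G : DGFunctor T (T.functors D)} {n : ℤ}
    (φ : (T.functors (T.functors D)).Hom F G n) :
    (T.functors D).Hom (F.flip.obj y) (G.flip.obj y) n :=
  (DGFunctor.post T (DGFunctor.ev D y)).map φ

/-- Restriction of a morphism of bimodules to a fixed contravariant variable. -/
noncomputable def fixLast (w : T.Obj) {F G : DGFunctor T (RMod T)} {n : ℤ}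
    (φ : (T.functors (RMod T)).Hom F G n) : (LMod T).Hom (slice F w) (slice G w) n :=
  (DGFunctor.post T (DGFunctor.ev (A := T.op) (DGCat.complexes.{u, u} k) w)).map φ

variable {Γ U}

/-- The components of a morphism of bimodules. -/
noncomputable abbrev comp₁ {F G : DGFunctor T (RMod T)} {n : ℤ}
    (φ : (Bimod₁ T).Hom F G n) (x w : T.Obj) : Cochain (cx (F.obj x) w) (cx (G.obj x) w) n :=
  (φ.1 x).1 w

/-- The components of a morphism of twofold bimodules. -/
noncomputable abbrev comp₂ {F G : DGFunctor T (T.functors (RMod T))} {n : ℤ}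
    (φ : (Bimod₂ T).Hom F G n) (x y w : T.Obj) :
    Cochain (cx ((F.obj x).obj y) w) (cx ((G.obj x).obj y) w) n :=
  ((φ.1 x).1 y).1 w

/-- The components of a morphism of threefold bimodules. -/
noncomputable abbrev comp₃ {F G : DGFunctor T (T.functors (T.functors (RMod T)))} {n : ℤ}
    (φ : (Bimod₃ T).Hom F G n) (x y z w : T.Obj) :
    Cochain (cx (((F.obj x).obj y).obj z) w) (cx (((G.obj x).obj y).obj z) w) n :=
  (((φ.1 x).1 y).1 z).1 w

/-- The components of a morphism of fourfold bimodules. -/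
noncomputable abbrev comp₄ {F G : DGFunctor T (T.functors (T.functors (T.functors (RMod T))))}
    {n : ℤ} (φ : (Bimod₄ T).Hom F G n) (x y z w v : T.Obj) :
    Cochain (cx ((((F.obj x).obj y).obj z).obj w) v) (cx ((((G.obj x).obj y).obj z).obj w) v) n :=
  ((((φ.1 x).1 y).1 z).1 w).1 v

/-- The composite `Γ(x, Γ(y, Γ(z, w))) → Γ(Γ(x, y), Γ(z, w)) → Γ(Γ(Γ(x, y), z), w)`. -/
noncomputable def pentagonTwo (α : Associator Γ) (x y z w v : T.Obj) :
    Cochain (tens ((((right₃ Γ (plugSnd Γ)).obj y).obj z).obj w) (sliceSnd Γ x v))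
      (tens ((((left₃ Γ (plugFst Γ)).obj x).obj y).obj z) (sliceFst Γ w v)) 0 :=
  ((((assocHom ((Γ.obj z).obj w) (Γ.obj y) (sliceSnd Γ x v)).comp
    (tensMapR ((Γ.obj z).obj w) (fixLast v ((α.1 x).1 y))) (add_zero 0)).comp
    (swapHom ((Γ.obj x).obj y) ((Γ.obj z).obj w) (Γ.comp (DGFunctor.post T
      (DGFunctor.ev (A := T.op) (DGCat.complexes.{u, u} k) v)))) (add_zero 0)).comp
    (tensMapR ((Γ.obj x).obj y) (fixLast v (fixSnd w (fixSnd z α)))) (add_zero 0)).comp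
    (assocInv ((Γ.obj x).obj y) (Γ.flip.obj z) (sliceFst Γ w v)) (add_zero 0)

/-- The composite
`Γ(x, Γ(y, Γ(z, w))) → Γ(x, Γ(Γ(y, z), w)) → Γ(Γ(x, Γ(y, z)), w) → Γ(Γ(Γ(x, y), z), w)`. -/
noncomputable def pentagonThree (α : Associator Γ) (x y z w v : T.Obj) :
    Cochain (tens ((((right₃ Γ (plugSnd Γ)).obj y).obj z).obj w) (sliceSnd Γ x v))
      (tens ((((left₃ Γ (plugFst Γ)).obj x).obj y).obj z) (sliceFst Γ w v)) 0 :=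
  ((((tensMapL (((α.1 y).1 z).1 w) (sliceSnd Γ x v)).comp
    (assocHom ((Γ.obj y).obj z) (Γ.flip.obj w) (sliceSnd Γ x v)) (add_zero 0)).comp
    (tensMapR ((Γ.obj y).obj z) (fixLast v (fixSnd w (α.1 x)))) (add_zero 0)).comp
    (assocInv ((Γ.obj y).obj z) (Γ.obj x) (sliceFst Γ w v)) (add_zero 0)).comp
    (tensMapL (((α.1 x).1 y).1 z) (sliceFst Γ w v)) (add_zero 0)

/-- The composite `Γ(x, Γ(U, y)) → Γ(Γ(x, U), y) → Γ(x, y)`. -/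
noncomputable def triangleTwo (α : Associator Γ) (r : RightUnitor Γ U) (x y w : T.Obj) :
    Cochain (tens (((plugFst Γ).obj U).obj y) (sliceSnd Γ x w)) (cx ((Γ.obj x).obj y) w) 0 :=
  ((((assocHom U (Γ.flip.obj y) (sliceSnd Γ x w)).comp
    (tensMapR U (fixLast w (fixSnd y (α.1 x)))) (add_zero 0)).comp
    (assocInv U (Γ.obj x) (sliceFst Γ y w)) (add_zero 0)).comp
    (tensMapL (r.1 x) (sliceFst Γ y w)) (add_zero 0)).comp
    (unitMap x (sliceFst Γ y w)) (add_zero 0)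

/-- The morphism `Γ(x, Γ(U, y)) → Γ(x, y)` induced by the left unit morphism. -/
noncomputable def triangleOne (l : LeftUnitor Γ U) (x y w : T.Obj) :
    Cochain (tens (((plugFst Γ).obj U).obj y) (sliceSnd Γ x w)) (cx ((Γ.obj x).obj y) w) 0 :=
  (tensMapL (l.1 y) (sliceSnd Γ x w)).comp (unitMap y (sliceSnd Γ x w)) (add_zero 0)

/-- The composite `Γ(x, U) → Γ(U, x) → T(-, x)`. -/
noncomputable def unitBraid (l : LeftUnitor Γ U) (c : Braiding Γ) (x w : T.Obj) :
    Cochain (cx (((plugSnd Γ).obj U).obj x) w) (cx ((idBimod T).obj x) w) 0 :=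
  (tensMapR U (fixLast w (c.1 x))).comp (comp₁ l x w) (add_zero 0)

/-- The composite `Γ(x, y) → Γ(y, x) → Γ(x, y)`. -/
noncomputable def braidTwice (c : Braiding Γ) (x y w : T.Obj) :
    Cochain (cx ((Γ.obj x).obj y) w) (cx ((Γ.obj x).obj y) w) 0 :=
  Cochain.comp (comp₂ c x y w) (comp₂ c y x w) (add_zero 0)

/-- The composite `Γ(x, Γ(y, z)) → Γ(x, Γ(z, y)) → Γ(Γ(x, z), y) → Γ(Γ(z, x), y)`. -/
noncomputable def hexagonOne (α : Associator Γ) (c : Braiding Γ) (x y z w : T.Obj) :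
    Cochain (tens ((Γ.obj y).obj z) (sliceSnd Γ x w)) (tens ((Γ.obj z).obj x) (sliceFst Γ y w)) 0 :=
  ((tensMapL ((c.1 y).1 z) (sliceSnd Γ x w)).comp (comp₃ α x z y w) (add_zero 0)).comp
    (tensMapL ((c.1 x).1 z) (sliceFst Γ y w)) (add_zero 0)

/-- The composite `Γ(x, Γ(y, z)) → Γ(Γ(x, y), z) → Γ(z, Γ(x, y)) → Γ(Γ(z, x), y)`. -/
noncomputable def hexagonTwo (α : Associator Γ) (c : Braiding Γ) (x y z w : T.Obj) :
    Cochain (tens ((Γ.obj y).obj z) (sliceSnd Γ x w)) (tens ((Γ.obj z).obj x) (sliceFst Γ y w)) 0 :=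
  (Cochain.comp (comp₃ α x y z w) (tensMapR ((Γ.obj x).obj y) (fixLast w (fixSnd z c)))
    (add_zero 0)).comp (comp₃ α z x y w) (add_zero 0)

/-- `(x, y) ↦ F(x, y)` evaluated at two right modules: `F ⊗ X ⊗ Y`. -/
noncomputable def con₂ (X Y : (RMod T).Obj) : DGFunctor (Bimod₂ T) (RMod T) :=
  (DGFunctor.post T (con Y)).comp (con X)

/-- A threefold bimodule evaluated at three right modules. -/
noncomputable def con₃ (X Y Z : (RMod T).Obj) : DGFunctor (Bimod₃ T) (RMod T) :=
  (DGFunctor.post T (DGFunctor.post T (con Z))).comp (con₂ X Y)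

end coherence

/-- A morphism of right modules whose value at every object is a homotopy equivalence. -/
def IsPointwiseH0Iso {X Y : (RMod T).Obj} (f : (RMod T).Hom X Y 0) : Prop :=
  ∀ w : T.Obj, (DGCat.complexes.{u, u} k).IsH0Iso (x := X.obj w) (y := Y.obj w) (f.1 w)

/-- A pseudo dg-tensor structure on `T`: a twofold bimodule `Γ`, a right module `U` and closed
morphisms of degree zero (associativity, units, symmetry) which become isomorphisms in `H⁰`
after evaluation, and which satisfy the axioms of a symmetric monoidal category up to homotopy. -/
structure PseudoDGTensor (T : DGCat.{u, u, u} k) where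
  /-- the tensor product `(x, y; w) ↦ Γ(x, y; w)` -/
  Γ : DGFunctor T (T.functors (RMod T))
  /-- the unit -/
  U : DGFunctor T.op (DGCat.complexes.{u, u} k)
  assoc : Associator Γ
  leftUnit : LeftUnitor Γ U
  rightUnit : RightUnitor Γ U
  braid : Braiding Γ
  assoc_closed : (Bimod₃ T).d 0 1 assoc = 0
  leftUnit_closed : (Bimod₁ T).d 0 1 leftUnit = 0
  rightUnit_closed : (Bimod₁ T).d 0 1 rightUnit = 0
  braid_closed : (Bimod₂ T).d 0 1 braid = 0
  /-- the values at three right modules are homotopy equivalences objectwise -/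
  assoc_modules : ∀ X Y Z : (RMod T).Obj, IsPointwiseH0Iso ((con₃ X Y Z).map assoc)
  leftUnit_modules : ∀ X : (RMod T).Obj, IsPointwiseH0Iso ((con X).map leftUnit)
  rightUnit_modules : ∀ X : (RMod T).Obj, IsPointwiseH0Iso ((con X).map rightUnit)
  braid_modules : ∀ X Y : (RMod T).Obj, IsPointwiseH0Iso ((con₂ X Y).map braid)
  /-- the values at three objects are isomorphisms in the homotopy category of right modules -/
  assoc_objects : ∀ x y z : T.Obj, (RMod T).IsH0Iso (((assoc.1 x).1 y).1 z)
  leftUnit_objects : ∀ x : T.Obj, (RMod T).IsH0Iso (leftUnit.1 x)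
  rightUnit_objects : ∀ x : T.Obj, (RMod T).IsH0Iso (rightUnit.1 x)
  braid_objects : ∀ x y : T.Obj, (RMod T).IsH0Iso ((braid.1 x).1 y)
  /-- the pentagon commutes up to the homotopy `η` -/
  pentagon : ∃ η : (Bimod₄ T).Hom (right₄ Γ (plugSnd Γ)) (left₄ Γ (plugFst Γ)) (-1),
    ∀ x y z w v : T.Obj, pentagonTwo assoc x y z w v - pentagonThree assoc x y z w v =
      δ (-1) 0 (comp₄ η x y z w v)
  /-- the unit triangle commutes up to the homotopy `μ` -/
  triangle : ∃ μ : (Bimod₂ T).Hom (rightUnit₂ (plugSnd Γ) (plugFst Γ) U) Γ (-1),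
    ∀ x y w : T.Obj, triangleTwo assoc rightUnit x y w - triangleOne leftUnit x y w =
      δ (-1) 0 (comp₂ μ x y w)
  /-- the symmetry is an involution up to the homotopy `σ` -/
  symmetry : ∃ σ : (Bimod₂ T).Hom Γ Γ (-1), ∀ x y w : T.Obj,
    braidTwice braid x y w - Cochain.ofHom (𝟙 (cx ((Γ.obj x).obj y) w)) =
      δ (-1) 0 (comp₂ σ x y w)
  /-- the symmetry exchanges the units up to the homotopy `κ` -/
  unit_symmetry : ∃ κ : (Bimod₁ T).Hom ((plugSnd Γ).obj U) (idBimod T) (-1), ∀ x w : T.Obj,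
    unitBraid leftUnit braid x w - comp₁ rightUnit x w = δ (-1) 0 (comp₁ κ x w)
  /-- the hexagon commutes up to the homotopy `ν` -/
  hexagon : ∃ ν : (Bimod₃ T).Hom (right₃ Γ (plugSnd Γ)) (leftRot₃ Γ (plugFst Γ)) (-1),
    ∀ x y z w : T.Obj, hexagonOne assoc braid x y z w - hexagonTwo assoc braid x y z w =
      δ (-1) 0 (comp₃ ν x y z w)

/-- The image of a closed morphism of degree zero. -/
def DGFunctor.mapClosed {A : DGCat.{u, u₁, v₁} k} {B : DGCat.{u, u₂, v₂} k} (F : DGFunctor A B)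
    {x y : A.Obj} (f : A.Closed x y) : B.Closed (F.obj x) (F.obj y) :=
  ⟨F.map f.1, by rw [← F.map_d, f.2, map_zero]⟩

/-- The chain map defined by a closed graded map of degree zero. -/
noncomputable def chainMap {K L : CochainComplex (ModuleCat.{u} k) ℤ}
    (f : (DGCat.complexes.{u, u} k).Closed K L) : K ⟶ L :=
  Cocycle.homOf (Cocycle.mk f.1 1 (zero_add 1) f.2)

/-- The chain map underlying a morphism of modules at an object. -/
noncomputable def atObj {A : DGCat.{u, u, u} k} {M N : DGFunctor A (DGCat.complexes.{u, u} k)}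
    (f : (A.functors (DGCat.complexes.{u, u} k)).Closed M N) (x : A.Obj) : M.obj x ⟶ N.obj x :=
  chainMap ((DGFunctor.ev (DGCat.complexes.{u, u} k) x).mapClosed f)

/-- The chain map `X ⊗_T f`. -/
noncomputable def tensorLeftMap (X : (RMod T).Obj) {M N : (LMod T).Obj} (f : (LMod T).Closed M N) :
    tens X M ⟶ tens X N := chainMap ((tensL X).mapClosed f)

/-- The chain map `g ⊗_T M`. -/
noncomputable def tensorRightMap {X Y : (RMod T).Obj} (g : (RMod T).Closed X Y) (M : (LMod T).Obj) :
    tens X M ⟶ tens Y M :=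
  chainMap (((tensor T).comp (DGFunctor.ev (DGCat.complexes.{u, u} k) M)).mapClosed g)

section perfect

/-- Objectwise quasi-isomorphisms of right modules. -/
def IsQuasiIso {M N : (RMod T).Obj} (f : (RMod T).Closed M N) : Prop :=
  ∀ x : T.Obj, QuasiIso (atObj (A := T.op) f x)

/-- Two right modules are isomorphic in the derived category. -/
def DerivedEquiv (M N : (RMod T).Obj) : Prop :=
  ∃ (Q : (RMod T).Obj) (f : (RMod T).Closed Q M) (g : (RMod T).Closed Q N),
    IsQuasiIso f ∧ IsQuasiIso g

/-- Cofibrant right modules: those with the left lifting property against all objectwise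
surjective quasi-isomorphisms. -/
def IsCofibrant (X : (RMod T).Obj) : Prop :=
  ∀ (M N : (RMod T).Obj) (p : (RMod T).Closed M N), IsQuasiIso p →
    (∀ (x : T.Obj) (n : ℤ), Function.Surjective (((atObj (A := T.op) p x).f n).hom)) →
    ∀ f : (RMod T).Closed X N, ∃ g : (RMod T).Closed X M,
      (RMod T).comp (add_zero 0) g.1 p.1 = f.1

open Classical in
/-- The closed morphisms `ι i : M i → S` exhibit `S` as the direct sum of the `M i`. -/
def IsDirectSum {I : Type u} (M : I → (RMod T).Obj) (S : (RMod T).Obj)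
    (ι : ∀ i, (RMod T).Closed (M i) S) : Prop :=
  ∀ (x : T.Obj) (n : ℤ), Function.Bijective (DirectSum.toModule k I ((cx S x).X n)
    (fun i => ((atObj (A := T.op) (ι i) x).f n).hom))

/-- A cofibrant right module is compact in the derived category if every morphism into a direct
sum factors, up to homotopy, through a finite subsum. -/
def IsCompactModule (X : (RMod T).Obj) : Prop :=
  ∀ (I : Type u) (M : I → (RMod T).Obj) (S : (RMod T).Obj) (ι : ∀ i, (RMod T).Closed (M i) S),
    IsDirectSum M S ι → ∀ f : (RMod T).Closed X S,
      ∃ (F : Finset I) (g : ∀ i, (RMod T).Closed X (M i)),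
        (RMod T).Homotopic f.1 (∑ i ∈ F, (RMod T).comp (add_zero 0) (g i).1 (ι i).1)

/-- Perfect right modules: cofibrant and compact. -/
def IsPerfectModule (X : (RMod T).Obj) : Prop := IsCofibrant X ∧ IsCompactModule X

/-- A pseudo dg-tensor structure is perfect if every `Γ(x, y)` is quasi-isomorphic to a
representable module and if `Γ ⊗ X ⊗ Y` is quasi-isomorphic to a perfect module whenever `X` and
`Y` are perfect. -/
def PseudoDGTensor.IsPerfect (S : PseudoDGTensor T) : Prop :=
  (∀ x y : T.Obj, ∃ z : T.Obj, DerivedEquiv ((S.Γ.obj x).obj y) (repMod T z)) ∧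
  ∀ X Y : (RMod T).Obj, IsPerfectModule X → IsPerfectModule Y →
    ∃ Z : (RMod T).Obj, IsPerfectModule Z ∧ DerivedEquiv ((con₂ X Y).obj S.Γ) Z

end perfect

section replete

/-- A class of chain maps is homotopically replete if it contains every chain map `g` which is
connected to a member `f` by a commutative square whose vertical maps are homotopy
equivalences. -/
def IsHomotopicallyReplete (P : MorphismProperty (CochainComplex (ModuleCat.{u} k) ℤ)) : Prop :=
  ∀ (X Y X' Y' : CochainComplex (ModuleCat.{u} k) ℤ) (f : X ⟶ Y) (g : X' ⟶ Y') (a : X ⟶ X')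
    (b : Y ⟶ Y'), HomologicalComplex.homotopyEquivalences _ _ a →
    HomologicalComplex.homotopyEquivalences _ _ b → f ≫ b = a ≫ g → P f → P g

/-- A class of chain maps is stable under tensoring with dg-modules over `T`; a morphism of
modules belongs to the class if all its underlying chain maps do. -/
def IsTensorStable (T : DGCat.{u, u, u} k)
    (P : MorphismProperty (CochainComplex (ModuleCat.{u} k) ℤ)) : Prop :=
  (∀ (M N : (LMod T).Obj) (f : (LMod T).Closed M N), (∀ x, P (atObj f x)) →
    ∀ X : (RMod T).Obj, P (tensorLeftMap X f)) ∧
  ∀ (X Y : (RMod T).Obj) (g : (RMod T).Closed X Y), (∀ x, P (atObj (A := T.op) g x)) →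
    ∀ M : (LMod T).Obj, P (tensorRightMap g M)

end replete

end Tensor

/-! The forward implications are instances of stability under tensoring: `Γ(x,y) ⊗ f` is the tensor
product of a right module with `f`, and `g ⊗ Γ(-,y;w)` is the tensor product of `g` with a left
module. The content lies in the converses, where `f` and `g` have to be recovered from their
products with `Γ`. The tool is the right unit `r : Γ(x,U) → h_x`: contracting one covariant variable
of `Γ` with `U` gives back, up to homotopy, the identity bimodule, and tensoring with the identity
bimodule changes nothing.

Left modules. If every `Γ(x,y) ⊗ f` lies in `P`, then for fixed `x` these maps are the components of
a morphism of left modules in the variable `y`. Tensoring it with `U` stays in `P`, and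
associativity of tensor products identifies the result with `Γ(x,U) ⊗ f` (`tensorLeftMap_con_mem`).
Since `r_x` is invertible in `H⁰` of right modules and `- ⊗ M` is a dg-functor, `r_x ⊗ M` and `r_x ⊗
N` are homotopy equivalences, so repleteness moves membership to `h_x ⊗ f`
(`tensorLeftMap_mem_of_isH0Iso`). The Yoneda isomorphism `h_x ⊗ M ≅ M(x)` ends the argument
(`atObj_mem_of_tensorLeftMap_repMod`).

Right modules. For fixed `w`, the maps `g ⊗_s Γ(s,t;w)` are the components of a morphism of left
modules in `t`. Tensoring it with `U` and exchanging the two contractions, with the Koszul sign,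
gives `g ⊗ Γ(-,U;w)` in `P` (`tensorRightMap_comp_tensL_mem`). Here `r` is used as a morphism of
left modules `Γ(-,U;w) → T(w,-)`. Invertibility of each `r_x` in the contravariant variable says
nothing about tensoring in the variable `x`; what serves is that `r` remains a homotopy equivalence
after inserting an arbitrary right module (`rightUnit_modules`). The isomorphism `X ⊗ T(w,-) ≅ X(w)`
then yields `g_w` in `P` (`atObj_mem_of_tensorRightMap_idBimod`).

Every step is one application of repleteness to a commutative square. Its vertical maps are either
canonical isomorphisms of complexes, checked on pure tensors together with their compatibility with
differentials and their naturality, or homotopy equivalences coming from `r`. -/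

/-! ### Repleteness squares in the language of cochains -/

section transfer

variable {k : Type u} [CommRing k] {K L K' L' : CochainComplex (ModuleCat.{u} k) ℤ}

theorem δ_eq_zero_of_ap {z : Cochain K L 0}
    (H : ∀ i j (_ : i + 1 = j) x, dd L i j (ap z i i (add_zero i) x) =
      ap z j j (add_zero j) (dd K i j x)) : δ 0 1 z = 0 := by
  refine ap_ext fun i j hij x => ?_
  rw [ap_d (zero_add 1) z i j j i hij hij (add_zero i) (add_zero j), H i j hij x,
    Int.negOnePow_zero, one_smul, sub_self]
  rfl

theorem chainMap_comp_chainMap {M : CochainComplex (ModuleCat.{u} k) ℤ}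
    (f : (DGCat.complexes.{u, u} k).Closed K L) (g : (DGCat.complexes.{u, u} k).Closed L M) :
    Cochain.ofHom (chainMap f ≫ chainMap g) = Cochain.comp f.1 g.1 (add_zero 0) := by
  rw [Cochain.ofHom_comp, chainMap, chainMap, Cocycle.cochain_ofHom_homOf_eq_coe,
    Cocycle.cochain_ofHom_homOf_eq_coe]
  rfl

/-- The morphisms of degree `-1` witnessing invertibility in `H⁰` of the dg-category of complexes
are exactly chain homotopies, through `Cochain.equivHomotopy`. -/
theorem homotopyEquivalences_chainMap_of_isH0Iso (f : (DGCat.complexes.{u, u} k).Closed K L)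
    (hf : (DGCat.complexes.{u, u} k).IsH0Iso f.1) :
    HomologicalComplex.homotopyEquivalences _ _ (chainMap f) := by
  obtain ⟨_, g, hg, ⟨h₁, e₁⟩, ⟨h₂, e₂⟩⟩ := hf
  let g' : (DGCat.complexes.{u, u} k).Closed L K := ⟨g, hg⟩
  refine ⟨⟨chainMap f, chainMap g', (Cochain.equivHomotopy _ _).symm ⟨h₁, ?_⟩,
    (Cochain.equivHomotopy _ _).symm ⟨h₂, ?_⟩⟩, rfl⟩
  · exact (chainMap_comp_chainMap f g').trans (eq_add_of_sub_eq e₁)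
  · exact (chainMap_comp_chainMap g' f).trans (eq_add_of_sub_eq e₂)

/-- A chain map that is bijective in each degree is an isomorphism of complexes. This is how the
canonical isomorphisms enter repleteness squares: only bijectivity is needed, and the inverse never
has to be shown to be a chain map. -/
theorem homotopyEquivalences_chainMap_of_bijective (f : (DGCat.complexes.{u, u} k).Closed K L)
    (hf : ∀ i, Function.Bijective (ap f.1 i i (add_zero i))) :
    HomologicalComplex.homotopyEquivalences _ _ (chainMap f) := by
  have (i : ℤ) : IsIso ((chainMap f).f i) :=
    (ConcreteCategory.isIso_iff_bijective ((chainMap f).f i)).2 (hf i)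
  have : IsIso (chainMap f) := HomologicalComplex.Hom.isIso_of_components _
  exact ⟨HomotopyEquiv.ofIso (asIso (chainMap f)), rfl⟩

/-- Repleteness restated for closed cochains, so that the square can be checked in the dg-category.
Membership travels along `a` and `b` only, from `f` to `g`; this fixes the direction in which each
canonical isomorphism is used below. -/
theorem IsHomotopicallyReplete.of_square
    {P : MorphismProperty (CochainComplex (ModuleCat.{u} k) ℤ)} (hP : IsHomotopicallyReplete P)
    {f : (DGCat.complexes.{u, u} k).Closed K L} {g : (DGCat.complexes.{u, u} k).Closed K' L'}
    {a : (DGCat.complexes.{u, u} k).Closed K K'} {b : (DGCat.complexes.{u, u} k).Closed L L'}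
    (ha : HomologicalComplex.homotopyEquivalences _ _ (chainMap a))
    (hb : HomologicalComplex.homotopyEquivalences _ _ (chainMap b))
    (sq : Cochain.comp f.1 b.1 (add_zero 0) = Cochain.comp a.1 g.1 (add_zero 0))
    (hf : P (chainMap f)) : P (chainMap g) := by
  refine hP _ _ _ _ (chainMap f) (chainMap g) (chainMap a) (chainMap b) ha hb ?_ hf
  apply Cochain.ofHom_injective
  rw [chainMap_comp_chainMap, chainMap_comp_chainMap, sq]

theorem comp_eq_comp_of_ap {M M' N : CochainComplex (ModuleCat.{u} k) ℤ} {f : Cochain M K 0}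
    {b : Cochain K N 0} {a : Cochain M M' 0} {g : Cochain M' N 0}
    (H : ∀ i x, ap b i i (add_zero i) (ap f i i (add_zero i) x) =
      ap g i i (add_zero i) (ap a i i (add_zero i) x)) :
    f.comp b (add_zero 0) = a.comp g (add_zero 0) := by
  refine ap_ext fun i j hij x => ?_
  obtain rfl : i = j := by omega
  rw [ap_comp (add_zero 0) f b i i i (add_zero i) (add_zero i),
    ap_comp (add_zero 0) a g i i i (add_zero i) (add_zero i)]
  exact H i x

end transfer

/-- A dg-functor carries the inverse and both homotopies along, since it commutes with composition
and differentials. It is applied to `- ⊗ M`, turning an invertible morphism of right modules into a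
homotopy equivalence of complexes. -/
theorem DGFunctor.map_isH0Iso {k : Type w} [CommRing k] {A : DGCat.{w, u₁, v₁} k}
    {B : DGCat.{w, u₂, v₂} k} (F : DGFunctor A B) {x y : A.Obj} {f : A.Hom x y 0}
    (hf : A.IsH0Iso f) : B.IsH0Iso (F.map f) := by
  obtain ⟨h, g, hg, ⟨s, hs⟩, ⟨t, ht⟩⟩ := hf
  refine ⟨by rw [← F.map_d, h, map_zero], F.map g, by rw [← F.map_d, hg, map_zero],
    ⟨F.map s, ?_⟩, ⟨F.map t, ?_⟩⟩
  · rw [← F.map_comp, ← F.map_id, ← map_sub, hs, F.map_d]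
  · rw [← F.map_comp, ← F.map_id, ← map_sub, ht, F.map_d]

/-! ### Evaluation on pure tensors -/

section canonicalIsos

variable {k : Type u} [CommRing k] {T : DGCat.{u, u, u} k}

theorem map_add_sgn {V W : Type*} [AddCommGroup V] [Module k V] [AddCommGroup W] [Module k W]
    (f : V →ₗ[k] W) (e : ℤˣ) (a b : V) : f (a + e • b) = f a + e • f b := by
  rw [map_add, map_sgn]

theorem map_add_sgn₂ {V W V' : Type*} [AddCommGroup V] [Module k V] [AddCommGroup W] [Module k W]
    [AddCommGroup V'] [Module k V'] (f : V →ₗ[k] V' →ₗ[k] W) (e : ℤˣ) (a b : V) (c : V') :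
    f (a + e • b) c = f a c + e • f b c := by
  rw [map_add, LinearMap.add_apply, map_sgn₂]

theorem act_id {A : DGCat.{u, u₁, v₁} k} (M : DGFunctor A (DGCat.complexes.{u, u} k)) (a : A.Obj)
    (i : ℤ) (m : (cx M a).X i) : act M (A.id a) i i (add_zero i) m = m := by
  unfold act
  rw [M.map_id]
  exact congrArg (fun t => t.hom m) (Cochain.ofHom_v (𝟙 (cx M a)) i)

theorem hap_act {A : DGCat.{u, u₁, v₁} k} {M N : DGFunctor A (DGCat.complexes.{u, u} k)}
    (φ : (A.functors (DGCat.complexes.{u, u} k)).Hom M N 0) {a b : A.Obj} {p i j : ℤ}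
    (f : A.Hom a b p) (h : i + p = j) (x : (cx M a).X i) :
    hap φ b j j (add_zero j) (act M f i j h x) =
      act N f i j h (hap φ a i i (add_zero i) x) := by
  rw [hap_nat φ f i i j j (add_zero i) h h (add_zero j) x, zero_mul, Int.negOnePow_zero, one_smul]

open Classical in
-- The canonical maps are given by `tlift` inside `mkC`, with anonymous proofs of compatibility with
-- the relations. Their formula on the direct sum holds by `rfl`, and this lemma extracts the value
-- on a pure tensor from it without mentioning those proofs.
theorem apply_tmk_of_toModule {X : (RMod T).Obj} {M : (LMod T).Obj} {n : ℤ} {V : Type u}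
    [AddCommGroup V] [Module k V] {f : TDeg X M n →ₗ[k] V}
    {φ : ∀ (z : T.Obj) (p q : ℤ), p + q = n → ((cx X z).X p →ₗ[k] (cx M z).X q →ₗ[k] V)}
    (hf : ∀ t, f ((trel X M n).mkQ t) = DirectSum.toModule k (TIdx T n) V
      (fun i => TensorProduct.lift (φ i.z i.p i.q i.h)) t) (z : T.Obj) {p q : ℤ} (h : p + q = n)
    (x : (cx X z).X p) (m : (cx M z).X q) : f (tmk X M n z p q h x m) = φ z p q h x m := by
  refine (hf _).trans ?_
  simp only [tpre, LinearMap.compr₂_apply, DirectSum.toModule_lof, TensorProduct.mk_apply,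
    TensorProduct.lift.tmul]

theorem tmapR_tmk_zero (X : (RMod T).Obj) {M M' : (LMod T).Obj} (ψ : (LMod T).Hom M M' 0) (i : ℤ)
    (z : T.Obj) {p q : ℤ} (h : p + q = i) (x : (cx X z).X p) (m : (cx M z).X q) :
    tmapR X ψ i i (add_zero i) (tmk X M i z p q h x m) =
      tmk X M' i z p q h x (hap ψ z q q (add_zero q) m) := by
  rw [tmapR_tmk ψ i i (add_zero i) z p q q h (add_zero q), zero_mul, Int.negOnePow_zero, one_smul]

/-! ### The Yoneda isomorphism `h_x ⊗ M ≅ M(x)` -/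

section unit

variable (x : T.Obj) (M : (LMod T).Obj)

/-- The map `T(-, x) ⊗_T M → M(x)` in a fixed degree. -/
noncomputable def unitLin (i : ℤ) : TDeg (repMod T x) M i →ₗ[k] (cx M x).X i :=
  ap (unitMap x M) i i (add_zero i)

theorem unitLin_tmk (z : T.Obj) {p q i : ℤ} (h : p + q = i) (e : (T.homComplex z x).X p)
    (m : (cx M z).X q) :
    unitLin x M i (tmk (repMod T x) M i z p q h e m) =
      act M (show T.Hom z x p from e) q i (by omega) m :=
  apply_tmk_of_toModule (X := repMod T x) (M := M) (f := unitLin x M i)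
    (φ := fun z p q h => actBilin M z x p q i (by omega)) (fun _ => rfl) z h e m

/-- On `e ⊗ m` this is the Leibniz rule for the action, `d(M(e)m) = M(de)m + (-1)^{|e|} M(e)(dm)`,
whose two terms match those of the differential of the tensor product. -/
theorem unitLin_tdiff {i j : ℤ} (hij : i + 1 = j) :
    dd (cx M x) i j ∘ₗ unitLin x M i = unitLin x M j ∘ₗ tdiff (repMod T x) M i j := by
  refine tdeg_ext fun z p q h e m => ?_
  rw [LinearMap.comp_apply, LinearMap.comp_apply, tdiff_tmk _ _ hij z p q _ _ h rfl rfl,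
    map_add_sgn]
  refine (congrArg _ (unitLin_tmk x M z h e m)).trans ((act_d (show T.Hom z x p from e) q i (q + 1)
    j (by omega) rfl hij m).trans (congrArg₂ (fun a b => a + Int.negOnePow p • b) ?_ ?_))
  · exact (unitLin_tmk x M z (by omega) (T.d p (p + 1) (show T.Hom z x p from e)) m).symm
  · exact (unitLin_tmk x M z (by omega) e (dd (cx M z) q (q + 1) m)).symm

theorem unitMap_closed : δ 0 1 (unitMap x M) = 0 :=
  δ_eq_zero_of_ap fun _ _ hij t => congrArg (fun s => s t) (unitLin_tdiff x M hij)

/-- The inverse is `m ↦ id_x ⊗ m`. -/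
theorem unitMap_bijective (i : ℤ) : Function.Bijective (ap (unitMap x M) i i (add_zero i)) := by
  refine Function.bijective_iff_has_inverse.2
    ⟨tmk (repMod T x) M i x 0 i (zero_add i) (T.id x), fun t => ?_, fun m => ?_⟩
  · refine congrArg (fun s => s t) (tdeg_ext
      (f := tmk (repMod T x) M i x 0 i (zero_add i) (T.id x) ∘ₗ unitLin x M i)
      (g := LinearMap.id) fun z p q h e m => ?_)
    -- Since `e` is the image of `id_x` under `h_x(e)`, the defining relation turns `e ⊗ m` into
    -- `id_x ⊗ M(e)(m)`; the sign is trivial because `id_x` has degree `0`.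
    have e1 := tmk_act (X := repMod T x) (M := M) (zero_add p) (by omega : q + p = i) h
      (zero_add i) (show T.Hom z x p from e) (T.id x) m
    have e2 : Int.negOnePow (p * 0) • T.comp (add_zero p) (show T.Hom z x p from e) (T.id x) =
        (show T.Hom z x p from e) := by
      rw [T.comp_id, mul_zero, Int.negOnePow_zero, one_smul]
    rw [zero_mul, Int.negOnePow_zero, one_smul] at e1
    exact ((congrArg _ (unitLin_tmk x M z h e m)).trans e1.symm).trans
      (congrArg (fun s => tmk (repMod T x) M i z p q h s m) e2)
  · exact (unitLin_tmk x M x (zero_add i) (T.id x) m).trans (act_id M x i m)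

variable {M} in
theorem unitMap_naturality {N : (LMod T).Obj} (f : (LMod T).Hom M N 0) :
    (tensMapR (repMod T x) f).comp (unitMap x N) (add_zero 0) =
      (unitMap x M).comp (f.1 x) (add_zero 0) := by
  refine comp_eq_comp_of_ap fun i t => ?_
  refine congrArg (fun s => s t) (tdeg_ext
    (f := unitLin x N i ∘ₗ tmapR (repMod T x) f i i (add_zero i))
    (g := hap f x i i (add_zero i) ∘ₗ unitLin x M i) fun z p q h e m => ?_)
  refine (congrArg _ (tmapR_tmk_zero (repMod T x) f i z h e m)).trans ?_
  refine (unitLin_tmk x N z h e _).trans ?_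
  exact (hap_act f _ _ m).symm.trans (congrArg _ (unitLin_tmk x M z h e m).symm)

end unit

/-! ### Associativity `X ⊗ (F ⊗ M) ≅ (X ⊗ F) ⊗ M` -/

section assoc

variable (X : (RMod T).Obj) (F : DGFunctor T (RMod T)) (M : (LMod T).Obj)

/-- The map `X ⊗_T (F ⊗_T M) → (X ⊗_T F) ⊗_T M` in a fixed degree. -/
noncomputable def assocInvLin (i : ℤ) : TDeg X (tensBimod F M) i →ₗ[k] TDeg ((con X).obj F) M i :=
  ap (assocInv X F M) i i (add_zero i)

/-- The map `(X ⊗_T F) ⊗_T M → X ⊗_T (F ⊗_T M)` in a fixed degree. -/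
noncomputable def assocHomLin (i : ℤ) : TDeg ((con X).obj F) M i →ₗ[k] TDeg X (tensBimod F M) i :=
  ap (assocHom X F M) i i (add_zero i)

theorem assocInvLin_tmk (s t : T.Obj) {p q r u v i : ℤ} (hv : q + r = v) (h : p + v = i)
    (hu : p + q = u) (h' : u + r = i) (x : (cx X s).X p) (f : (cx (F.obj s) t).X q)
    (m : (cx M t).X r) :
    assocInvLin X F M i
        (tmk X (tensBimod F M) i s p v h x (tmk (F.obj s) M v t q r hv f m)) =
      tmk ((con X).obj F) M i t u r h' (tmk X (slice F t) u s p q hu x f) m :=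
  (apply_tmk_of_toModule (X := X) (M := tensBimod F M) (φ := fun s p q h =>
    (assocInvMid X F M s p q i (by omega)).flip) (fun _ => rfl) s h x _).trans
    (assocInvMid_tmk X F M s t h hv hu h' f m x)

theorem assocHomLin_tmk (s t : T.Obj) {p q r u v i : ℤ} (hv : q + r = v) (h : p + v = i)
    (hu : p + q = u) (h' : u + r = i) (x : (cx X s).X p) (f : (cx (F.obj s) t).X q)
    (m : (cx M t).X r) :
    assocHomLin X F M i
        (tmk ((con X).obj F) M i t u r h' (tmk X (slice F t) u s p q hu x f) m) =
      tmk X (tensBimod F M) i s p v h x (tmk (F.obj s) M v t q r hv f m) :=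
  (apply_tmk_of_toModule (X := (con X).obj F) (M := M)
    (φ := fun t p q h => assocMid X F M t p q i (by omega)) (fun _ => rfl) t h' _ m).trans
    (assocMid_tmk X F M t s h' hu hv h x f m)

variable {X F M}

/-- Pure tensors generate at both levels, so linear maps out of the iterated tensor product are
determined on triples `x ⊗ (e ⊗ m)`. Every identity between canonical maps out of this product is
checked there. -/
theorem tens_tensBimod_ext {n : ℤ} {V : Type u} [AddCommGroup V] [Module k V]
    {f g : TDeg X (tensBimod F M) n →ₗ[k] V}
    (H : ∀ s t p q r v (h : p + v = n) (hv : q + r = v) (x : (cx X s).X p)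
      (e : (cx (F.obj s) t).X q) (m : (cx M t).X r),
      f (tmk X (tensBimod F M) n s p v h x (tmk (F.obj s) M v t q r hv e m)) =
        g (tmk X (tensBimod F M) n s p v h x (tmk (F.obj s) M v t q r hv e m))) : f = g :=
  tdeg_ext fun s p v h x y => congrArg (fun a => a y)
    (tdeg_ext (X := F.obj s) (M := M) (f := f ∘ₗ tmk X (tensBimod F M) n s p v h x)
      (g := g ∘ₗ tmk X (tensBimod F M) n s p v h x) fun t q r hv e m => H s t p q r v h hv x e m)

/-- The counterpart for triples bracketed to the left. The inner tensor sits in the first argument,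
so the inner extensionality is applied with `m` held fixed, through `flip`. -/
theorem tens_con_ext {n : ℤ} {V : Type u} [AddCommGroup V] [Module k V]
    {f g : TDeg ((con X).obj F) M n →ₗ[k] V}
    (H : ∀ s t p q r v (h : v + r = n) (hv : p + q = v) (x : (cx X s).X p)
      (e : (cx (F.obj s) t).X q) (m : (cx M t).X r),
      f (tmk ((con X).obj F) M n t v r h (tmk X (slice F t) v s p q hv x e) m) =
        g (tmk ((con X).obj F) M n t v r h (tmk X (slice F t) v s p q hv x e) m)) : f = g :=
  tdeg_ext fun t v r h y m => congrArg (fun a => a y)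
    (tdeg_ext (X := X) (M := slice F t) (f := f ∘ₗ (tmk ((con X).obj F) M n t v r h).flip m)
      (g := g ∘ₗ (tmk ((con X).obj F) M n t v r h).flip m)
      fun s p q hv x e => H s t p q r v h hv x e m)

variable (X F M)

/-- The two rebracketings carry no signs and undo each other on triples. -/
theorem assocInv_bijective (i : ℤ) :
    Function.Bijective (ap (assocInv X F M) i i (add_zero i)) := by
  refine Function.bijective_iff_has_inverse.2
    ⟨assocHomLin X F M i, fun t => ?_, fun t => ?_⟩
  · refine congrArg (fun s => s t) (tens_tensBimod_ext
      (f := assocHomLin X F M i ∘ₗ assocInvLin X F M i)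
      (g := LinearMap.id) fun s t p q r v h hv x e m => ?_)
    exact (congrArg _ (assocInvLin_tmk X F M s t hv h rfl (by omega) x e m)).trans
      (assocHomLin_tmk X F M s t hv h rfl (by omega) x e m)
  · refine congrArg (fun s => s t) (tens_con_ext
      (f := assocInvLin X F M i ∘ₗ assocHomLin X F M i)
      (g := LinearMap.id) fun s t p q r v h hv x e m => ?_)
    exact (congrArg _ (assocHomLin_tmk X F M s t rfl (by omega) hv h x e m)).trans
      (assocInvLin_tmk X F M s t rfl (by omega) hv h x e m)

/-- Both bracketings give the same three terms: `dx`, then `(-1)^p` times the one with `de`, then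
`(-1)^{p+q}` times the one with `dm`. Only the grouping of signs and sums differs. -/
theorem assocInvLin_tdiff {i j : ℤ} (hij : i + 1 = j) :
    tdiff ((con X).obj F) M i j ∘ₗ assocInvLin X F M i =
      assocInvLin X F M j ∘ₗ tdiff X (tensBimod F M) i j := by
  refine tens_tensBimod_ext fun s t p q r v h hv x e m => ?_
  have d1 := tdiff_tmk X (tensBimod F M) hij s p v _ _ h rfl rfl x (tmk (F.obj s) M v t q r hv e m)
  have d2 := tdiff_tmk (F.obj s) M (rfl : v + 1 = v + 1) t q r _ _ hv rfl rfl e m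
  have d3 := tdiff_tmk ((con X).obj F) M hij t (p + q) r _ _ (by omega) rfl rfl
    (tmk X (slice F t) (p + q) s p q rfl x e) m
  have d4 := tdiff_tmk X (slice F t) (rfl : p + q + 1 = p + q + 1) s p q _ _ rfl rfl rfl x e
  have a0 := assocInvLin_tmk X F M s t hv h rfl (by omega) x e m
  have a1 := assocInvLin_tmk X F M s t hv (by omega : p + 1 + v = j)
    (by omega : p + 1 + q = p + q + 1) (by omega) (dd (cx X s) p (p + 1) x) e m
  have a2 := assocInvLin_tmk X F M s t (by omega) (by omega : p + (v + 1) = j)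
    (by omega : p + (q + 1) = p + q + 1) (by omega) x (dd (cx (F.obj s) t) q (q + 1) e) m
  have a3 := assocInvLin_tmk X F M s t (by omega) (by omega : p + (v + 1) = j) rfl (by omega)
    x e (dd (cx M t) r (r + 1) m)
  have c1 := (congrArg (fun y => tmk ((con X).obj F) M j t (p + q + 1) r (by omega) y m) d4).trans
    (map_add_sgn₂ (tmk ((con X).obj F) M j t (p + q + 1) r (by omega)) _ _ _ m)
  have c2 := (congrArg (fun y => tmk X (tensBimod F M) j s p (v + 1) (by omega) x y) d2).trans
    (map_add_sgn (tmk X (tensBimod F M) j s p (v + 1) (by omega) x) _ _ _)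
  have c3 := (congrArg (assocInvLin X F M j) c2).trans (map_add_sgn _ _ _ _)
  have c4 := (congrArg (assocInvLin X F M j) d1).trans (map_add_sgn _ _ _ _)
  refine ((congrArg _ a0).trans d3).trans (Eq.trans ?_ c4.symm)
  refine (congrArg (fun y => y + _) c1).trans
    (Eq.trans ?_ (congrArg (fun y => _ + Int.negOnePow p • y) c3).symm)
  rw [a1, a2, a3, smul_add, smul_smul, ← Int.negOnePow_add, add_assoc]
  rfl

theorem assocInv_closed : δ 0 1 (assocInv X F M) = 0 :=
  δ_eq_zero_of_ap fun _ _ hij t => congrArg (fun s => s t) (assocInvLin_tdiff X F M hij)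

variable {M}

/-- The morphism `F ⊗_T f`. -/
noncomputable def tensBimodMap {N : (LMod T).Obj} (f : (LMod T).Closed M N) :
    (LMod T).Closed (tensBimod F M) (tensBimod F N) :=
  ⟨⟨fun s => tensMapR (F.obj s) f.1, fun a b p m h h' e => by
      obtain rfl : p = m := by omega
      -- Naturality in `s` is the interchange of `F(e) ⊗ id` with `id ⊗ f`; the Koszul sign
      -- disappears because `f` has degree `0`.
      have := tensMapL_nat h' h (F.map e) f.1
      rw [mul_zero, Int.negOnePow_zero, one_smul] at this
      rw [zero_mul, Int.negOnePow_zero, one_smul]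
      exact this.symm⟩,
    DGCat.functors_ext fun s => ((tensL (F.obj s)).mapClosed f).2⟩

/-- Both composites send `x ⊗ (e ⊗ m)` to `(x ⊗ e) ⊗ f(m)`. No sign appears since `f` has degree
`0`. -/
theorem assocInv_naturality {N : (LMod T).Obj} (f : (LMod T).Closed M N) :
    (tensMapR X (tensBimodMap F f).1).comp (assocInv X F N) (add_zero 0) =
      (assocInv X F M).comp (tensMapR ((con X).obj F) f.1) (add_zero 0) := by
  refine comp_eq_comp_of_ap fun i t => ?_
  refine congrArg (fun s => s t) (tens_tensBimod_ext
    (f := assocInvLin X F N i ∘ₗ tmapR X (tensBimodMap F f).1 i i (add_zero i))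
    (g := tmapR ((con X).obj F) f.1 i i (add_zero i) ∘ₗ assocInvLin X F M i)
    fun s t p q r v h hv x e m => ?_)
  have e1 := tmapR_tmk_zero X (tensBimodMap F f).1 i s h x (tmk (F.obj s) M v t q r hv e m)
  have e2 := tmapR_tmk_zero (F.obj s) f.1 v t hv e m
  have e3 := e1.trans (congrArg (tmk X (tensBimod F N) i s p v h x) e2)
  refine (congrArg (assocInvLin X F N i) e3).trans ?_
  refine (assocInvLin_tmk X F N s t hv h rfl (by omega) x e _).trans ?_
  refine Eq.trans ?_ (congrArg (tmapR ((con X).obj F) f.1 i i (add_zero i))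
    (assocInvLin_tmk X F M s t hv h rfl (by omega) x e m)).symm
  exact (tmapR_tmk_zero ((con X).obj F) f.1 i t (by omega)
    (tmk X (slice F t) (p + q) s p q rfl x e) m).symm

end assoc

end canonicalIsos
-- Exchange of two contractions
section swap

variable {k : Type u} [CommRing k] {T : DGCat.{u, u, u} k}

section

variable (X Y : (RMod T).Obj) (G : DGFunctor T (LMod T))

/-- The map `Y ⊗_T (X ⊗_T G) → X ⊗_T (Y ⊗_T G)` in a fixed degree. -/
noncomputable def swapLin (i : ℤ) :
    TDeg Y (G.flip.comp (tensL X)) i →ₗ[k] TDeg X (G.comp (tensL Y)) i :=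
  ap (swapHom X Y G) i i (add_zero i)

theorem swapLin_tmk (s t : T.Obj) {p₁ p₂ q v w i : ℤ} (hv : p₁ + p₂ = v) (h : q + v = i)
    (hw : q + p₂ = w) (h' : p₁ + w = i) (y : (cx Y t).X q) (x : (cx X s).X p₁)
    (g : (cx (G.obj s) t).X p₂) :
    swapLin X Y G i (tmk Y (G.flip.comp (tensL X)) i t q v h y
        (tmk X (G.flip.obj t) v s p₁ p₂ hv x g)) =
      Int.negOnePow (p₁ * q) •
        tmk X (G.comp (tensL Y)) i s p₁ w h' x (tmk Y (G.obj s) w t q p₂ hw y g) :=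
  (apply_tmk_of_toModule (X := Y) (M := G.flip.comp (tensL X)) (φ := fun t q p h =>
    (swapMid X Y G t p q i (by omega)).flip) (fun _ => rfl) t h y _).trans
    (swapMid_tmk X Y G s t (by omega) hv hw h' x g y)

variable {X Y G} in
theorem tens_comp_tensL_ext {n : ℤ} {V : Type u} [AddCommGroup V] [Module k V]
    {f g : TDeg X (G.comp (tensL Y)) n →ₗ[k] V}
    (H : ∀ s t p q r v (h : p + v = n) (hv : q + r = v) (x : (cx X s).X p)
      (y : (cx Y t).X q) (m : (cx (G.obj s) t).X r),
      f (tmk X (G.comp (tensL Y)) n s p v h x (tmk Y (G.obj s) v t q r hv y m)) =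
        g (tmk X (G.comp (tensL Y)) n s p v h x (tmk Y (G.obj s) v t q r hv y m))) : f = g :=
  tdeg_ext fun s p v h x y => congrArg (fun a => a y)
    (tdeg_ext (X := Y) (M := G.obj s) (f := f ∘ₗ tmk X (G.comp (tensL Y)) n s p v h x)
      (g := g ∘ₗ tmk X (G.comp (tensL Y)) n s p v h x) fun t q r hv y m => H s t p q r v h hv x y m)

/-- Exchanging twice multiplies by the square of `(-1)^{|x||y|}`, which is `1`. The inverse of the
exchange for `G` is the exchange for `G.flip`, and `G.flip.flip` agrees with `G` by unfolding. -/
theorem swapLin_swapLin (i : ℤ) : swapLin Y X G.flip i ∘ₗ swapLin X Y G i = LinearMap.id := by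
  refine tens_comp_tensL_ext (X := Y) (Y := X) (G := G.flip) fun t s q p₁ p₂ v h hv y x g => ?_
  have e1 := swapLin_tmk X Y G s t hv h rfl (by omega) y x g
  have e2 := swapLin_tmk Y X G.flip t s (rfl : q + p₂ = q + p₂) (by omega) hv h x y g
  refine (congrArg (swapLin Y X G.flip i) e1).trans ((map_sgn _ _ _).trans ?_)
  refine (congrArg (fun a => Int.negOnePow (p₁ * q) • a) e2).trans ?_
  rw [smul_smul, ← Int.negOnePow_add, sgn_congr (b := 0) ⟨p₁ * q, by ring⟩, Int.negOnePow_zero,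
    one_smul]
  rfl

/-- The same cancellation in the other order. The type ascription replaces `G.flip.flip` by `G`, so
that both composites are endomorphisms of the expected modules. -/
theorem swapLin_flip_swapLin (i : ℤ) :
    swapLin X Y G i ∘ₗ (swapLin Y X G.flip i :
      TDeg X (G.comp (tensL Y)) i →ₗ[k] TDeg Y (G.flip.comp (tensL X)) i) = LinearMap.id := by
  refine tens_comp_tensL_ext fun s t p₁ q p₂ v h hv x y g => ?_
  have e1 : (swapLin Y X G.flip i : TDeg X (G.comp (tensL Y)) i →ₗ[k] _) _ = _ :=
    swapLin_tmk Y X G.flip t s hv h rfl (by omega) x y g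
  have e2 := swapLin_tmk X Y G s t (rfl : p₁ + p₂ = p₁ + p₂) (by omega) hv h y x g
  refine (congrArg (swapLin X Y G i) e1).trans ((map_sgn _ _ _).trans ?_)
  refine (congrArg (fun a => Int.negOnePow (q * p₁) • a) e2).trans ?_
  rw [smul_smul, ← Int.negOnePow_add, sgn_congr (b := 0) ⟨p₁ * q, by ring⟩, Int.negOnePow_zero,
    one_smul]
  rfl

theorem swapHom_bijective (i : ℤ) : Function.Bijective (ap (swapHom X Y G) i i (add_zero i)) :=
  Function.bijective_iff_has_inverse.2 ⟨swapLin Y X G.flip i,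
    LinearMap.congr_fun (swapLin_swapLin X Y G i),
    LinearMap.congr_fun (swapLin_flip_swapLin X Y G i)⟩

/-- The sign `(-1)^{|x||y|}` is what makes the exchange a chain map: each side has one term for each
of `dx`, `dy`, `dg`, and raising the degree of `x` or of `y` by one changes the exchange sign by
exactly the sign with which the differential passes the other factor. -/
theorem swapLin_tdiff {i j : ℤ} (hij : i + 1 = j) :
    tdiff X (G.comp (tensL Y)) i j ∘ₗ swapLin X Y G i =
      swapLin X Y G j ∘ₗ tdiff Y (G.flip.comp (tensL X)) i j := by
  refine tens_comp_tensL_ext (X := Y) (Y := X) (G := G.flip) fun t s q p r v h hv y x g => ?_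
  have d1 := tdiff_tmk Y (G.flip.comp (tensL X)) hij t q v _ _ h rfl rfl y
    (tmk X (G.flip.obj t) v s p r hv x g)
  have d2 := tdiff_tmk X (G.flip.obj t) (rfl : v + 1 = v + 1) s p r _ _ hv rfl rfl x g
  have d3 := tdiff_tmk X (G.comp (tensL Y)) hij s p (q + r) _ _ (by omega) rfl rfl x
    (tmk Y (G.obj s) (q + r) t q r rfl y g)
  have d4 := tdiff_tmk Y (G.obj s) (rfl : q + r + 1 = q + r + 1) t q r _ _ rfl rfl rfl y g
  have a0 := swapLin_tmk X Y G s t hv h rfl (by omega) y x g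
  have a1 := swapLin_tmk X Y G s t hv (by omega : q + 1 + v = j)
    (by omega : q + 1 + r = q + r + 1) (by omega) (dd (cx Y t) q (q + 1) y) x g
  have a2 := swapLin_tmk X Y G s t (by omega) (by omega : q + (v + 1) = j) (rfl : q + r = q + r)
    (by omega) y (dd (cx X s) p (p + 1) x) g
  have a3 := swapLin_tmk X Y G s t (by omega) (by omega : q + (v + 1) = j)
    (by omega : q + (r + 1) = q + r + 1) (by omega) y x (dd (cx (G.obj s) t) r (r + 1) g)
  have c1 := (congrArg (fun z => tmk X (G.comp (tensL Y)) j s p (q + r + 1) (by omega) x z) d4).trans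
    (map_add_sgn (tmk X (G.comp (tensL Y)) j s p (q + r + 1) (by omega) x) _ _ _)
  have c2 := (congrArg (fun z => tmk Y (G.flip.comp (tensL X)) j t q (v + 1) (by omega) y z) d2).trans
    (map_add_sgn (tmk Y (G.flip.comp (tensL X)) j t q (v + 1) (by omega) y) _ _ _)
  have c3 := (congrArg (swapLin X Y G j) c2).trans (map_add_sgn _ _ _ _)
  have c4 := (congrArg (swapLin X Y G j) d1).trans (map_add_sgn _ _ _ _)
  refine ((congrArg _ a0).trans ((map_sgn _ _ _).trans (congrArg _ d3))).trans
    (Eq.trans ?_ c4.symm)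
  refine (congrArg (fun z => Int.negOnePow (p * q) • (_ + Int.negOnePow p • z)) c1).trans
    (Eq.trans ?_ (congrArg (fun z => _ + Int.negOnePow q • z)
      (c3.trans (congrArg₂ (fun z z' => z + Int.negOnePow p • z') a2 a3))).symm)
  rw [a1]
  simp only [smul_add, smul_smul, ← Int.negOnePow_add]
  -- The signs of the `dy`, `dx` and `dg` terms, in this order. The two sides list the `dx` and `dy`
  -- terms in opposite order, which the remaining commutations repair.
  rw [sgn_congr (a := p * q + p) (b := p * (q + 1)) ⟨0, by ring⟩,
    sgn_congr (a := q + (p + 1) * q) (b := p * q) ⟨q, by ring⟩,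
    sgn_congr (a := p * q + (p + q)) (b := q + (p + p * q)) ⟨0, by ring⟩, ← add_assoc,
    add_comm (Int.negOnePow (p * (q + 1)) • _), add_assoc]
  exact (congrArg _ (add_comm _ _)).trans (add_assoc _ _ _).symm

theorem swapHom_closed : δ 0 1 (swapHom X Y G) = 0 :=
  δ_eq_zero_of_ap fun _ _ hij t => congrArg (fun s => s t) (swapLin_tdiff X Y G hij)

variable {X} {X' : (RMod T).Obj}

/-- The morphism `f ⊗_T G` of left modules. -/
noncomputable def compTensLMap (f : (RMod T).Closed X X') (G : DGFunctor T (LMod T)) :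
    (LMod T).Closed (G.comp (tensL X)) (G.comp (tensL X')) :=
  ⟨⟨fun t => tensMapL f.1 (G.obj t), fun _ _ _ _ h h' e => tensMapL_nat h h' f.1 (G.map e)⟩,
    -- Closedness holds at each `t`: the differential of `f ⊗ id` is `df ⊗ id`, and `df = 0`.
    DGCat.functors_ext fun t => (tensMapL_d (zero_add 1) f.1).symm.trans
      ((congrArg (fun g => tensMapL g (G.obj t)) f.2).trans (by
        have := map_zero ((tensor T).map (x := X) (y := X') (n := 1))
        exact congrArg (fun φ => φ.1 (G.obj t)) this))⟩

/-- Both composites send `y ⊗ (x ⊗ g)` to `(-1)^{|x||y|} f(x) ⊗ (y ⊗ g)`; the sign agrees because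
`f` preserves the degree of `x`. -/
theorem swapHom_naturality (f : (RMod T).Closed X X') :
    (tensMapR Y (compTensLMap f G.flip).1).comp (swapHom X' Y G) (add_zero 0) =
      (swapHom X Y G).comp (tensMapL f.1 (G.comp (tensL Y))) (add_zero 0) := by
  refine comp_eq_comp_of_ap fun i t => ?_
  refine congrArg (fun s => s t) (tens_comp_tensL_ext (X := Y) (Y := X) (G := G.flip)
    (f := swapLin X' Y G i ∘ₗ tmapR Y (compTensLMap f G.flip).1 i i (add_zero i))
    (g := tmapL f.1 (G.comp (tensL Y)) i i (add_zero i) ∘ₗ swapLin X Y G i)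
    fun t s q p r v h hv y x g => ?_)
  have e1 := tmapR_tmk_zero Y (compTensLMap f G.flip).1 i t h y
    (tmk X (G.flip.obj t) v s p r hv x g)
  have e2 := tmapL_tmk (M := G.flip.obj t) f.1 v v (add_zero v) s p r p hv (add_zero p) x g
  have e3 := e1.trans (congrArg (tmk Y (G.flip.comp (tensL X')) i t q v h y) e2)
  refine (congrArg (swapLin X' Y G i) e3).trans ?_
  refine (swapLin_tmk X' Y G s t hv h rfl (by omega) y _ g).trans ?_
  refine Eq.trans ?_ (congrArg (tmapL f.1 (G.comp (tensL Y)) i i (add_zero i))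
    (swapLin_tmk X Y G s t hv h rfl (by omega) y x g)).symm
  refine Eq.trans ?_ (map_sgn _ _ _).symm
  exact congrArg _ (tmapL_tmk (M := G.comp (tensL Y)) f.1 i i (add_zero i) s p (q + r) p (by omega)
    (add_zero p) x (tmk Y (G.obj s) (q + r) t q r rfl y g)).symm

end

end swap

/-! ### The Yoneda isomorphism `X ⊗ T(w,-) ≅ X(w)` -/

section coYoneda

variable {k : Type u} [CommRing k] {T : DGCat.{u, u, u} k} (X : (RMod T).Obj) (w : T.Obj)

/-- The map `X(z) ⊗ T(w, z) → X(w)`, `x ⊗ e ↦ (-1)^{|x||e|} X(e)(x)`. -/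
noncomputable def coYonedaBilin (z : T.Obj) (p q i : ℤ) (h : p + q = i) :
    (cx X z).X p →ₗ[k] (cx (slice (idBimod T) w) z).X q →ₗ[k] (cx X w).X i :=
  Int.negOnePow (p * q) • (actBilin (T := T.op) X z w q p i (by omega)).flip

/-- The map `X ⊗_T T(w, -) → X(w)` in a fixed degree. -/
noncomputable def coYonedaLin (i : ℤ) : TDeg X (slice (idBimod T) w) i →ₗ[k] (cx X w).X i :=
  tlift (X := X) (M := slice (idBimod T) w) (fun z p q h => coYonedaBilin X w z p q i h) (by
    intro a b r p q p' q' hp hq h h' f x e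
    have e1 := act_comp (T := T.op) X (by omega : r + q = q') f (show T.Hom w a q from e)
      p p' i hp h h' x
    -- Functoriality of `X` produces a composite in `T.op`; rewriting it as a composite in `T` costs
    -- the Koszul sign `(-1)^{rq}`.
    have e2 : act (A := T.op) X (T.op.comp (by omega : r + q = q') f (show T.Hom w a q from e))
        p i h' x = Int.negOnePow (r * q) •
          act (A := T.op) X (T.comp hq (show T.Hom w a q from e) f) p i h' x :=
      map_sgn₂ (actBilin (T := T.op) X b w q' p i (by omega)) _ _ x
    have e3 := congrArg (fun t => Int.negOnePow (p' * q) • t) (e1.symm.trans e2)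
    refine e3.trans ?_
    refine Eq.trans ?_ (smul_smul (Int.negOnePow (p * r)) (Int.negOnePow (p * q'))
      (act (A := T.op) X (T.comp hq (show T.Hom w a q from e) f) p i h' x)).symm
    rw [smul_smul, ← Int.negOnePow_add, ← Int.negOnePow_add]
    congr 1
    exact sgn_congr ⟨r * q - p * r, by rw [← hp, ← hq]; ring⟩)

theorem coYonedaLin_tmk (z : T.Obj) {p q i : ℤ} (h : p + q = i) (x : (cx X z).X p)
    (e : (cx (slice (idBimod T) w) z).X q) :
    coYonedaLin X w i (tmk X (slice (idBimod T) w) i z p q h x e) =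
      Int.negOnePow (p * q) • act (A := T.op) X (show T.Hom w z q from e) p i h x :=
  tlift_tmk (X := X) (M := slice (idBimod T) w) (fun z p q h => coYonedaBilin X w z p q i h) _
    z p q h x e

/-- The isomorphism `X ⊗_T T(w, -) → X(w)`, `x ⊗ e ↦ (-1)^{|x||e|} X(e)(x)`. -/
noncomputable def coYoneda : Cochain (tens X (slice (idBimod T) w)) (cx X w) 0 :=
  mkC (K := tens X (slice (idBimod T) w)) (L := cx X w) fun i j hij =>
    (show i = j by omega) ▸ coYonedaLin X w i

/-- Leibniz for the action gives `X(de)(x)` first and `X(e)(dx)` second, the opposite of the order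
in the tensor differential. The factor `(-1)^{|x||e|}` makes the signs agree after this exchange. -/
theorem coYonedaLin_tdiff {i j : ℤ} (hij : i + 1 = j) :
    dd (cx X w) i j ∘ₗ coYonedaLin X w i =
      coYonedaLin X w j ∘ₗ tdiff X (slice (idBimod T) w) i j := by
  refine tdeg_ext fun z p q h x e => ?_
  rw [LinearMap.comp_apply, LinearMap.comp_apply, tdiff_tmk _ _ hij z p q _ _ h rfl rfl,
    map_add_sgn]
  refine (congrArg _ (coYonedaLin_tmk X w z h x e)).trans ((map_sgn _ _ _).trans ?_)
  refine (congrArg _ (act_d (A := T.op) (show T.Hom w z q from e) p i (p + 1) j (by omega) rfl hij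
    x)).trans ?_
  refine Eq.trans ?_ (congrArg₂ (fun a b => a + Int.negOnePow p • b)
    (coYonedaLin_tmk X w z (by omega) (dd (cx X z) p (p + 1) x) e)
    (coYonedaLin_tmk X w z (by omega) x (T.d q (q + 1) (show T.Hom w z q from e)))).symm
  rw [smul_add, smul_smul, smul_smul, ← Int.negOnePow_add, ← Int.negOnePow_add, add_comm,
    sgn_congr (a := p * q + q) (b := (p + 1) * q) ⟨0, by ring⟩,
    sgn_congr (a := p + p * (q + 1)) (b := p * q) ⟨p, by ring⟩]

theorem coYoneda_closed : δ 0 1 (coYoneda X w) = 0 :=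
  δ_eq_zero_of_ap fun _ _ hij t => congrArg (fun s => s t) (coYonedaLin_tdiff X w hij)

/-- The inverse is `x ↦ x ⊗ id_w`. -/
theorem coYoneda_bijective (i : ℤ) : Function.Bijective (ap (coYoneda X w) i i (add_zero i)) := by
  refine Function.bijective_iff_has_inverse.2
    ⟨(tmk X (slice (idBimod T) w) i w i 0 (add_zero i)).flip (T.id w), fun t => ?_, fun x => ?_⟩
  · refine congrArg (fun s => s t) (tdeg_ext
      (f := (tmk X (slice (idBimod T) w) i w i 0 (add_zero i)).flip (T.id w) ∘ₗ coYonedaLin X w i)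
      (g := LinearMap.id) fun z p q h x e => ?_)
    -- The relation gives `X(e)(x) ⊗ id_w = (-1)^{|x||e|} x ⊗ e`, and this sign cancels the one in
    -- the definition of the map.
    have e1 := tmk_act (X := X) (M := slice (idBimod T) w) h (zero_add q) (add_zero i) h
      (show T.Hom w z q from e) x (T.id w)
    have e2 : T.comp (zero_add q) (T.id w) (show T.Hom w z q from e) = _ := T.id_comp _
    refine (congrArg ((tmk X (slice (idBimod T) w) i w i 0 (add_zero i)).flip (T.id w))
      (coYonedaLin_tmk X w z h x e)).trans ((map_sgn _ _ _).trans ?_)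
    refine (congrArg _ e1).trans ?_
    rw [smul_smul, ← Int.negOnePow_add, sgn_congr (b := 0) ⟨p * q, by ring⟩, Int.negOnePow_zero,
      one_smul]
    exact congrArg (tmk X (slice (idBimod T) w) i z p q h x) e2
  · refine (coYonedaLin_tmk X w w (add_zero i) x (T.id w)).trans ?_
    rw [mul_zero, Int.negOnePow_zero, one_smul]
    exact act_id (A := T.op) X w i x

variable {X} in
theorem coYoneda_naturality {Y : (RMod T).Obj} (f : (RMod T).Hom X Y 0) :
    (tensMapL f (slice (idBimod T) w)).comp (coYoneda Y w) (add_zero 0) =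
      (coYoneda X w).comp (f.1 w) (add_zero 0) := by
  refine comp_eq_comp_of_ap fun i t => ?_
  refine congrArg (fun s => s t) (tdeg_ext
    (f := coYonedaLin Y w i ∘ₗ tmapL f (slice (idBimod T) w) i i (add_zero i))
    (g := hap f w i i (add_zero i) ∘ₗ coYonedaLin X w i) fun z p q h x e => ?_)
  refine (congrArg _ (tmapL_tmk f i i (add_zero i) z p q p h (add_zero p) x e)).trans ?_
  refine (coYonedaLin_tmk Y w z h _ e).trans ?_
  refine Eq.trans ?_ (congrArg (hap f w i i (add_zero i)) (coYonedaLin_tmk X w z h x e)).symm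
  refine Eq.trans ?_ (map_sgn (hap f w i i (add_zero i)) _ _).symm
  exact congrArg _ (hap_act (A := T.op) f (show T.Hom w z q from e) h x).symm

end coYoneda
-- Moving membership in `P` along the canonical maps
section descent

variable {k : Type u} [CommRing k] {T : DGCat.{u, u, u} k}
  {P : MorphismProperty (CochainComplex (ModuleCat.{u} k) ℤ)}

theorem atObj_mem_of_tensorLeftMap_repMod (hP : IsHomotopicallyReplete P) {M N : (LMod T).Obj}
    (f : (LMod T).Closed M N) (x : T.Obj) (h : P (tensorLeftMap (repMod T x) f)) :
    P (atObj f x) :=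
  hP.of_square (K := tens (repMod T x) M) (L := tens (repMod T x) N) (K' := cx M x) (L' := cx N x)
    (f := (tensL (repMod T x)).mapClosed f)
    (g := (DGFunctor.ev (DGCat.complexes.{u, u} k) x).mapClosed f)
    (a := ⟨unitMap x M, unitMap_closed x M⟩) (b := ⟨unitMap x N, unitMap_closed x N⟩)
    (homotopyEquivalences_chainMap_of_bijective _ (unitMap_bijective x M))
    (homotopyEquivalences_chainMap_of_bijective _ (unitMap_bijective x N))
    (unitMap_naturality x f.1) h

/-- The vertical maps `r ⊗ M` and `r ⊗ N` are homotopy equivalences because `- ⊗ M` and `- ⊗ N` are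
dg-functors on right modules. The square commutes strictly, as `r ⊗ id` and `id ⊗ f` commute in
degree `0`. -/
theorem tensorLeftMap_mem_of_isH0Iso (hP : IsHomotopicallyReplete P) {X X' : (RMod T).Obj}
    (r : (RMod T).Closed X X') (hr : (RMod T).IsH0Iso r.1) {M N : (LMod T).Obj}
    (f : (LMod T).Closed M N) (h : P (tensorLeftMap X f)) : P (tensorLeftMap X' f) :=
  let E (M : (LMod T).Obj) := (tensor T).comp (DGFunctor.ev (DGCat.complexes.{u, u} k) M)
  hP.of_square (K := tens X M) (L := tens X N) (K' := tens X' M) (L' := tens X' N)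
    (f := (tensL X).mapClosed f) (g := (tensL X').mapClosed f)
    (a := (E M).mapClosed r) (b := (E N).mapClosed r)
    (homotopyEquivalences_chainMap_of_isH0Iso _ ((E M).map_isH0Iso hr))
    (homotopyEquivalences_chainMap_of_isH0Iso _ ((E N).map_isH0Iso hr))
    (by
      have := tensMapL_nat (add_zero 0) (add_zero 0) r.1 f.1
      rw [zero_mul, Int.negOnePow_zero, one_smul] at this
      exact this.symm) h

/-- The hypothesis says that the morphism `F ⊗ f` of left modules lies in `P`; stability gives `X ⊗
(F ⊗ f)`, and rebracketing gives `(X ⊗ F) ⊗ f`. -/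
theorem tensorLeftMap_con_mem (hP : IsHomotopicallyReplete P) (hT : IsTensorStable T P)
    (X : (RMod T).Obj) (F : DGFunctor T (RMod T)) {M N : (LMod T).Obj} (f : (LMod T).Closed M N)
    (h : ∀ y, P (tensorLeftMap (F.obj y) f)) : P (tensorLeftMap ((con X).obj F) f) :=
  hP.of_square (K := tens X (tensBimod F M)) (L := tens X (tensBimod F N))
    (K' := tens ((con X).obj F) M) (L' := tens ((con X).obj F) N)
    (f := (tensL X).mapClosed (tensBimodMap F f)) (g := (tensL ((con X).obj F)).mapClosed f)
    (a := ⟨assocInv X F M, assocInv_closed X F M⟩) (b := ⟨assocInv X F N, assocInv_closed X F N⟩)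
    (homotopyEquivalences_chainMap_of_bijective _ (assocInv_bijective X F M))
    (homotopyEquivalences_chainMap_of_bijective _ (assocInv_bijective X F N))
    (assocInv_naturality X F f) (hT.1 _ _ (tensBimodMap F f) h X)

theorem atObj_mem_of_tensorRightMap_idBimod (hP : IsHomotopicallyReplete P) {X Y : (RMod T).Obj}
    (g : (RMod T).Closed X Y) (w : T.Obj) (h : P (tensorRightMap g (slice (idBimod T) w))) :
    P (atObj (A := T.op) g w) :=
  hP.of_square (K := tens X (slice (idBimod T) w)) (L := tens Y (slice (idBimod T) w))
    (K' := cx X w) (L' := cx Y w)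
    (f := ((tensor T).comp (DGFunctor.ev (DGCat.complexes.{u, u} k) _)).mapClosed g)
    (g := (DGFunctor.ev (A := T.op) (DGCat.complexes.{u, u} k) w).mapClosed g)
    (a := ⟨coYoneda X w, coYoneda_closed X w⟩) (b := ⟨coYoneda Y w, coYoneda_closed Y w⟩)
    (homotopyEquivalences_chainMap_of_bijective _ (coYoneda_bijective X w))
    (homotopyEquivalences_chainMap_of_bijective _ (coYoneda_bijective Y w))
    (coYoneda_naturality w g.1) h

/-- Only the two vertical maps `X ⊗ r` and `Y ⊗ r` have to be homotopy equivalences, and this is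
assumed instead of invertibility of `r` in `H⁰` of left modules. The weaker form is the one
available for the right unit with its contravariant variable fixed. -/
theorem tensorRightMap_mem_of_isH0Iso (hP : IsHomotopicallyReplete P) {M M' : (LMod T).Obj}
    (r : (LMod T).Closed M M') {X Y : (RMod T).Obj}
    (hX : (DGCat.complexes.{u, u} k).IsH0Iso ((tensL X).map r.1))
    (hY : (DGCat.complexes.{u, u} k).IsH0Iso ((tensL Y).map r.1))
    (g : (RMod T).Closed X Y) (h : P (tensorRightMap g M)) : P (tensorRightMap g M') :=
  hP.of_square (K := tens X M) (L := tens Y M) (K' := tens X M') (L' := tens Y M')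
    (f := ((tensor T).comp (DGFunctor.ev (DGCat.complexes.{u, u} k) M)).mapClosed g)
    (g := ((tensor T).comp (DGFunctor.ev (DGCat.complexes.{u, u} k) M')).mapClosed g)
    (a := (tensL X).mapClosed r) (b := (tensL Y).mapClosed r)
    (homotopyEquivalences_chainMap_of_isH0Iso _ hX)
    (homotopyEquivalences_chainMap_of_isH0Iso _ hY)
    (by
      have := tensMapL_nat (add_zero 0) (add_zero 0) g.1 r.1
      rw [zero_mul, Int.negOnePow_zero, one_smul] at this
      exact this) h

/-- The maps `g ⊗_s G(s,t)` are the components of a morphism of left modules in `t`, so stability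
applies to it with the right module `U`. The exchange then moves `g` from the inner contraction to
the outer one. -/
theorem tensorRightMap_comp_tensL_mem (hP : IsHomotopicallyReplete P) (hT : IsTensorStable T P)
    (U : (RMod T).Obj) (G : DGFunctor T (LMod T)) {X Y : (RMod T).Obj} (g : (RMod T).Closed X Y)
    (h : ∀ t, P (tensorRightMap g (G.flip.obj t))) :
    P (tensorRightMap g (G.comp (tensL U))) :=
  hP.of_square (K := tens U (G.flip.comp (tensL X))) (L := tens U (G.flip.comp (tensL Y)))
    (K' := tens X (G.comp (tensL U))) (L' := tens Y (G.comp (tensL U)))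
    (f := (tensL U).mapClosed (compTensLMap g G.flip))
    (g := ((tensor T).comp (DGFunctor.ev (DGCat.complexes.{u, u} k) _)).mapClosed g)
    (a := ⟨swapHom X U G, swapHom_closed X U G⟩) (b := ⟨swapHom Y U G, swapHom_closed Y U G⟩)
    (homotopyEquivalences_chainMap_of_bijective _ (swapHom_bijective X U G))
    (homotopyEquivalences_chainMap_of_bijective _ (swapHom_bijective Y U G))
    (swapHom_naturality U G g) (hT.1 _ _ (compTensLMap g G.flip) h U)

end descent

/-! ### Recovering a morphism from its product with `Γ` -/

theorem PseudoDGTensor.atObj_mem_of_tensorLeftMap {k : Type u} [CommRing k] {T : DGCat.{u, u, u} k}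
    (S : PseudoDGTensor T) {P : MorphismProperty (CochainComplex (ModuleCat.{u} k) ℤ)}
    (hP : IsHomotopicallyReplete P) (hT : IsTensorStable T P) {M N : (LMod T).Obj}
    (f : (LMod T).Closed M N) (h : ∀ x y : T.Obj, P (tensorLeftMap ((S.Γ.obj x).obj y) f))
    (x : T.Obj) : P (atObj f x) :=
  atObj_mem_of_tensorLeftMap_repMod hP f x
    (tensorLeftMap_mem_of_isH0Iso hP (X := (con S.U).obj (S.Γ.obj x))
      ⟨S.rightUnit.1 x, (S.rightUnit_objects x).1⟩ (S.rightUnit_objects x) f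
      -- The module `Γ(x,U)` is the contraction of `U` with the second variable of `Γ`, so only the
      -- products with `Γ(x,y)` for this fixed `x` enter.
      (tensorLeftMap_con_mem hP hT S.U (S.Γ.obj x) f (h x)))

theorem PseudoDGTensor.atObj_mem_of_tensorRightMap {k : Type u} [CommRing k]
    {T : DGCat.{u, u, u} k} (S : PseudoDGTensor T)
    {P : MorphismProperty (CochainComplex (ModuleCat.{u} k) ℤ)}
    (hP : IsHomotopicallyReplete P) (hT : IsTensorStable T P) {X Y : (RMod T).Obj}
    (g : (RMod T).Closed X Y) (h : ∀ y w : T.Obj, P (tensorRightMap g (sliceFst S.Γ y w)))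
    (w : T.Obj) : P (atObj (A := T.op) g w) := by
  -- `G` is `(s,t) ↦ Γ(s,t;w)`: contracting its second variable with `U` gives the left module
  -- `Γ(-,U;w)`, the source of the right unit at `w`, while fixing `t` gives the slices of the
  -- hypothesis.
  let G : DGFunctor T (LMod T) :=
    S.Γ.comp (DGFunctor.post T (DGFunctor.ev (A := T.op) (DGCat.complexes.{u, u} k) w))
  have hG := tensorRightMap_comp_tensL_mem hP hT S.U G g fun t => h t w
  have hr : (LMod T).d 0 1 (fixLast w S.rightUnit) = 0 :=
    ((DGFunctor.post T (DGFunctor.ev (A := T.op) (DGCat.complexes.{u, u} k) w)).mapClosed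
      ⟨S.rightUnit, S.rightUnit_closed⟩).2
  exact atObj_mem_of_tensorRightMap_idBimod hP g w
    (tensorRightMap_mem_of_isH0Iso hP (M := G.comp (tensL S.U)) ⟨fixLast w S.rightUnit, hr⟩
      -- The value at `w` of the right unit with `X` inserted is `X ⊗ -` applied to the morphism
      -- `Γ(-,U;w) → T(w,-)`, and likewise for `Y`.
      (S.rightUnit_modules X w) (S.rightUnit_modules Y w) g hG)

theorem mainTheorem7 {k : Type u} [CommRing k] (T : DGCat.{u, u, u} k) (S : PseudoDGTensor T)
    (hS : S.IsPerfect) (P : MorphismProperty (CochainComplex (ModuleCat.{u} k) ℤ))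
    (hP : IsHomotopicallyReplete P) (hT : IsTensorStable T P) :
    (∀ (M N : (LMod T).Obj) (f : (LMod T).Closed M N),
      (∀ x : T.Obj, P (atObj f x)) ↔
        ∀ x y : T.Obj, P (tensorLeftMap ((S.Γ.obj x).obj y) f)) ∧
    ∀ (X Y : (RMod T).Obj) (g : (RMod T).Closed X Y),
      (∀ x : T.Obj, P (atObj (A := T.op) g x)) ↔
        ∀ y w : T.Obj, P (tensorRightMap g (sliceFst S.Γ y w)) :=
  ⟨fun M N f => ⟨fun h _ _ => hT.1 M N f h _, S.atObj_mem_of_tensorLeftMap hP hT f⟩,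
    fun X Y g => ⟨fun h _ _ => hT.2 X Y g h _, S.atObj_mem_of_tensorRightMap hP hT g⟩⟩
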